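/- Let $\Bbbk$ be a field of characteristic $0$, $\otimes=\otimes_{\Bbbk}$, let $A$ be a unital associative $\Bbbk$-algebra and $(e_s)_{s\in I}$ a finite complete family of orthogonal idempotents of $A$, $B=\bigoplus_{s\in I}\Bbbk e_s$. **Definitions.** A $B$-linear double bracket on $A$ is a $\Bbbk$-bilinear map $\{\!\{-,-\}\!\}:A\times A\to A\otimes A$ that vanishes when one argument lies in $B$ and satisfies $\{\!\{a,b\}\!\}=-\{\!\{b,a\}\!\}''\otimes\{\!\{b,a\}\!\}'$ and $\{\!\{a,bc\}\!\}=\{\!\{a,b\}\!\}c+b\{\!\{a,c\}\!\}$, where $b(x\otimes y)c=bx\otimes yc$. With $\tau(x\otimes y\otimes z)=z\otimes x\otimes y$, its triple bracket is $$\{\!\{a,b,c\}\!\}=\{\!\{a,\{\!\{b,c\}\!\}'\}\!\}\otimes\{\!\{b,c\}\!\}''+\tau\big(\{\!\{b,\{\!\{c,a\}\!\}'\}\!\}\otimes\{\!\{c,a\}\!\}''\big)+\tau^2\big(\{\!\{c,\{\!\{a,b\}\!\}'\}\!\}\otimes\{\!\{a,b\}\!\}''\big).$$ A double derivation of $A$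 over $B$ is a $\Bbbk$-linear map $\delta:A\to A\otimes A$ with $\delta(ab)=a\delta(b)+\delta(a)b$ and $\delta(B)=0$. Products of two or three double derivations define brackets by $$\{\!\{a,b\}\!\}_{\delta_1\delta_2}=\delta_2(b)'\delta_1(a)''\otimes\delta_1(a)'\delta_2(b)''-\delta_1(b)'\delta_2(a)''\otimes\delta_2(a)'\delta_1(b)'',$$ $$\{\!\{a,b,c\}\!\}_{\delta_1\delta_2\delta_3}=T(a,b,c)+\tau T(b,c,a)+\tau^2T(c,a,b),\quad T(a,b,c)=\delta_3(c)'\delta_1(a)''\otimes\delta_1(a)'\delta_2(b)''\otimes\delta_2(b)'\delta_3(c)''.$$ The gauge elements are $E_s(a)=ae_s\otimes e_s-e_s\otimes e_sa$. The pair $(A,\{\!\{-,-\}\!\})$ is a double quasi-Poisson algebra over $B$ if $\{\!\{-,-\}\!\}$ is a $B$-linear double bracket with $\{\!\{-,-,-\}\!\}=\frac1{12}\sum_{s\in I}\{\!\{-,-,-\}\!\}_{E_s^3}$. Let $1\neq2$ be two elements of $I$ and $\mu=1-e_1-e_2$. Put $$\bar A=A\ast_{\Bbbk e_1\oplus\Bbbk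 e_2\oplus\Bbbk\mu}\big(\mathrm{Mat}_2(\Bbbk)\oplus\Bbbk\mu\big),$$ where $e_1,e_2$ are identified with the diagonal matrix units and $e_{12},e_{21}$ denote the other two, put $\epsilon=1-e_2$, and let $A^f=\epsilon\bar A\epsilon$ be the fusion algebra obtained by fusing $e_2$ onto $e_1$, an algebra over $B^f=\bigoplus_{s\ne2}\Bbbk e_s$. A $B$-linear double bracket on $A$ (respectively, a double derivation of $A$ over $B$) extends uniquely to a double bracket on (double derivation of) $\bar A$ that is linear over (vanishes on) $\mathrm{Mat}_2(\Bbbk)\oplus\Bbbk\mu$. The bracket induced on $A^f$ is $\{\!\{x,y\}\!\}_{\mathrm{ind}}=(\epsilon\otimes\epsilon)\{\!\{x,y\}\!\}(\epsilon\otimes\epsilon)$, computed with the extended bracket on $\bar A$; for a double derivation $\delta$ of $A$ over $B$, with extension $\bar\delta$ to $\bar A$, $\mathrm{Tr}(\delta)$ is the double derivation of $A^f$ over $B^f$ given by $$\mathrm{Tr}(\delta)(x)=\epsilon\bar\delta(x)'\epsilon\otimes\epsilon\bar\delta(x)''\epsilon+\epsilon\bar\delta(x)'e_{21}\epsilon\otimes\epsilon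 e_{12}\bar\delta(x)''\epsilon .$$ **Theorem.** Let $(A,\{\!\{-,-\}\!\})$ be a double quasi-Poisson algebra over $B$. Then $A^f$, with $$\{\!\{-,-\}\!\}^f=\{\!\{-,-\}\!\}_{\mathrm{ind}}+\{\!\{-,-\}\!\}_{\mathrm{fus}},\qquad \{\!\{-,-\}\!\}_{\mathrm{fus}}=-\tfrac12\{\!\{-,-\}\!\}_{\mathrm{Tr}(E_1)\mathrm{Tr}(E_2)},$$ is a double quasi-Poisson algebra over $B^f$. -/

import Mathlib

open scoped TensorProduct

noncomputable section

namespace DoubleBrackets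

/-! ### Double and triple brackets, double derivations -/

section Brackets

variable {k : Type*} [Field k] {A : Type*} [Ring A] [Algebra k A]

/-- The outerAct bimodule action on `A ⊗ A`: `b (x ⊗ y) c = b x ⊗ y c`. -/
def outerAct (b c : A) : A ⊗[k] A →ₗ[k] A ⊗[k] A :=
  TensorProduct.map (LinearMap.mulLeft k b) (LinearMap.mulRight k c)

/-- The innerAct bimodule action on `A ⊗ A`: `b * (x ⊗ y) * c = x c ⊗ b y`. -/
def innerAct (b c : A) : A ⊗[k] A →ₗ[k] A ⊗[k] A :=
  TensorProduct.map (LinearMap.mulRight k c) (LinearMap.mulLeft k b)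

/-- `δ` is a double derivation of `A` relative to `B`, i.e. an element of `Der_B(A, A ⊗ A)` for the
outerAct bimodule structure. -/
structure IsDoubleDerivation (B : Subalgebra k A) (δ : A →ₗ[k] A ⊗[k] A) : Prop where
  leibniz : ∀ a b : A, δ (a * b) = outerAct a 1 (δ b) + outerAct 1 b (δ a)
  map_base : ∀ b ∈ B, δ b = 0

/-- `br` is a `B`-linear double bracket on `A`. -/
structure IsDoubleBracket (B : Subalgebra k A) (br : A →ₗ[k] A →ₗ[k] A ⊗[k] A) : Prop where
  antisymm : ∀ a b : A, br a b = -TensorProduct.comm k A A (br b a)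
  leibniz : ∀ a b c : A, br a (b * c) = outerAct 1 c (br a b) + outerAct b 1 (br a c)
  base_right : ∀ a : A, ∀ b ∈ B, br a b = 0
  base_left : ∀ b ∈ B, ∀ a : A, br b a = 0

/-- The cyclic permutation `x ⊗ y ⊗ z ↦ z ⊗ x ⊗ y` of `A ⊗ A ⊗ A`. -/
def cyc : (A ⊗[k] A) ⊗[k] A →ₗ[k] (A ⊗[k] A) ⊗[k] A :=
  (TensorProduct.assoc k A A A).symm.toLinearMap ∘ₗ
    (TensorProduct.comm k (A ⊗[k] A) A).toLinearMap

/-- The triple bracket associated with a double bracket: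
`⦃a, ⦃b,c⦄'⦄ ⊗ ⦃b,c⦄'' + τ (⦃b, ⦃c,a⦄'⦄ ⊗ ⦃c,a⦄'') + τ² (⦃c, ⦃a,b⦄'⦄ ⊗ ⦃a,b⦄'')`. -/
def tripleBracket (br : A →ₗ[k] A →ₗ[k] A ⊗[k] A) (a b c : A) : (A ⊗[k] A) ⊗[k] A :=
  (br a).rTensor A (br b c) + cyc ((br b).rTensor A (br c a)) +
    cyc (cyc ((br c).rTensor A (br a b)))

/-! ### Brackets defined by bivectors and trivectors -/

/-- The bilinear operation `(x₁ ⊗ y₁, x₂ ⊗ y₂) ↦ x₂ y₁ ⊗ x₁ y₂`. -/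
def contract₂ : A ⊗[k] A →ₗ[k] A ⊗[k] A →ₗ[k] A ⊗[k] A :=
  TensorProduct.homTensorHomMap (RingHom.id k) A A A A ∘ₗ
    TensorProduct.map (LinearMap.mul k A).flip (LinearMap.mul k A) ∘ₗ
      (TensorProduct.comm k A A).toLinearMap

theorem contract₂_tmul (x₁ y₁ x₂ y₂ : A) :
    contract₂ (k := k) (x₁ ⊗ₜ y₁) (x₂ ⊗ₜ y₂) = (x₂ * y₁) ⊗ₜ (x₁ * y₂) := by
  simp [contract₂]

/-- The linear operation `(x₁ ⊗ y₁) ⊗ (x₂ ⊗ y₂) ↦ y₁ ⊗ x₁ y₂ ⊗ x₂`. -/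
def chain : (A ⊗[k] A) ⊗[k] (A ⊗[k] A) →ₗ[k] (A ⊗[k] A) ⊗[k] A :=
  LinearMap.rTensor A (LinearMap.lTensor A (LinearMap.mul' k A)) ∘ₗ
    LinearMap.rTensor A (TensorProduct.assoc k A A A).toLinearMap ∘ₗ
      (TensorProduct.assoc k (A ⊗[k] A) A A).symm.toLinearMap ∘ₗ
        TensorProduct.map (TensorProduct.comm k A A).toLinearMap
          (TensorProduct.comm k A A).toLinearMap

/-- The outerAct action of `x ⊗ y` on `A ⊗ A ⊗ A`: `u ⊗ v ⊗ w ↦ x u ⊗ v ⊗ w y`. -/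
def outer₃ : A ⊗[k] A →ₗ[k] (A ⊗[k] A) ⊗[k] A →ₗ[k] (A ⊗[k] A) ⊗[k] A :=
  TensorProduct.homTensorHomMap (RingHom.id k) (A ⊗[k] A) A (A ⊗[k] A) A ∘ₗ
    TensorProduct.map (LinearMap.rTensorHom A ∘ₗ LinearMap.mul k A) (LinearMap.mul k A).flip

/-- The operation `(x₁ ⊗ y₁, x₂ ⊗ y₂, x₃ ⊗ y₃) ↦ x₃ y₁ ⊗ x₁ y₂ ⊗ x₂ y₃`, linear in each
argument. -/
def contract₃ (t₁ t₂ t₃ : A ⊗[k] A) : (A ⊗[k] A) ⊗[k] A :=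
  outer₃ t₃ (chain (t₁ ⊗ₜ t₂))

theorem contract₃_tmul (x₁ y₁ x₂ y₂ x₃ y₃ : A) :
    contract₃ (k := k) (x₁ ⊗ₜ y₁) (x₂ ⊗ₜ y₂) (x₃ ⊗ₜ y₃) =
      ((x₃ * y₁) ⊗ₜ (x₁ * y₂)) ⊗ₜ (x₂ * y₃) := by
  simp [contract₃, chain, outer₃]

/-- The double bracket defined by the bivector `δ₁ δ₂`:
`⦃a,b⦄ = δ₂(b)' δ₁(a)'' ⊗ δ₁(a)' δ₂(b)'' - δ₁(b)' δ₂(a)'' ⊗ δ₂(a)' δ₁(b)''`. -/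
def bivectorBracket (δ₁ δ₂ : A →ₗ[k] A ⊗[k] A) : A →ₗ[k] A →ₗ[k] A ⊗[k] A :=
  contract₂.compl₁₂ δ₁ δ₂ - contract₂.compl₁₂ δ₂ δ₁

/-- The triple bracket defined by the trivector `δ₁ δ₂ δ₃`: the sum over the cyclic group of order
three of `τ^i ∘ ⦃-,-,-⦄~ ∘ τ^(-i)`, where
`⦃a,b,c⦄~ = δ₃(c)' δ₁(a)'' ⊗ δ₁(a)' δ₂(b)'' ⊗ δ₂(b)' δ₃(c)''`. -/
def trivectorBracket (δ₁ δ₂ δ₃ : A →ₗ[k] A ⊗[k] A) (a b c : A) : (A ⊗[k] A) ⊗[k] A :=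
  contract₃ (δ₁ a) (δ₂ b) (δ₃ c) + cyc (contract₃ (δ₁ b) (δ₂ c) (δ₃ a)) +
    cyc (cyc (contract₃ (δ₁ c) (δ₂ a) (δ₃ b)))

/-! ### Gauge elements and double quasi-Poisson brackets -/

variable (k) in
/-- The gauge element attached to `e`: `a ↦ a e ⊗ e - e ⊗ e a`. -/
def gaugeElt (e : A) : A →ₗ[k] A ⊗[k] A :=
  (TensorProduct.mk k A A).flip e ∘ₗ LinearMap.mulRight k e -
    TensorProduct.mk k A A e ∘ₗ LinearMap.mulLeft k e

/-- `A` with the bracket `br` is a double quasi-Poisson algebra over `B = ⨁ k e_s`: the `e_s` form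
a complete family of orthogonal idempotents of `A`, `br` is a `B`-linear double bracket, and its
triple bracket is the one defined by `1/12 ∑ E_s³`, the `E_s` being the gauge elements. -/
structure IsDoubleQuasiPoisson {I : Type*} [Fintype I] (e : I → A)
    (br : A →ₗ[k] A →ₗ[k] A ⊗[k] A) : Prop where
  idem : CompleteOrthogonalIdempotents e
  bracket : IsDoubleBracket (Algebra.adjoin k (Set.range e)) br
  quasiPoisson : ∀ a b c : A, tripleBracket br a b c =
    (1 / 12 : k) • ∑ s, trivectorBracket (gaugeElt k (e s)) (gaugeElt k (e s)) (gaugeElt k (e s)) a b c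

end Brackets

section Actions

variable {k : Type*} [Field k] {P : Type*} [Ring P] [Algebra k P]

theorem outerAct_mul (x x' y y' : P) (t : P ⊗[k] P) :
    outerAct (x * x') (y' * y) t = outerAct x y (outerAct x' y' t) := by
  induction t with
  | zero => simp
  | tmul a b => simp [outerAct, mul_assoc]
  | add a b ha hb => simp [ha, hb]

theorem innerAct_mul (x x' y y' : P) (t : P ⊗[k] P) :
    innerAct (x * x') (y' * y) t = innerAct x y (innerAct x' y' t) := by
  induction t with
  | zero => simp
  | tmul a b => simp [innerAct, mul_assoc]
  | add a b ha hb => simp [ha, hb]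

theorem outerAct_innerAct (x x' y y' : P) (t : P ⊗[k] P) :
    outerAct x y (innerAct x' y' t) = innerAct x' y' (outerAct x y t) := by
  induction t with
  | zero => simp
  | tmul a b => simp [outerAct, innerAct, mul_assoc]
  | add a b ha hb => simp [ha, hb]

theorem comm_outerAct (x y : P) (t : P ⊗[k] P) :
    TensorProduct.comm k P P (outerAct x y t) = innerAct x y (TensorProduct.comm k P P t) := by
  induction t with
  | zero => simp
  | tmul a b => simp [outerAct, innerAct]
  | add a b ha hb => simp [ha, hb]

theorem comm_innerAct (x y : P) (t : P ⊗[k] P) :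
    TensorProduct.comm k P P (innerAct x y t) = outerAct x y (TensorProduct.comm k P P t) := by
  induction t with
  | zero => simp
  | tmul a b => simp [outerAct, innerAct]
  | add a b ha hb => simp [ha, hb]

theorem outerAct_one_one (t : P ⊗[k] P) : outerAct 1 1 t = t := by
  simp [outerAct]

theorem innerAct_one_one (t : P ⊗[k] P) : innerAct 1 1 t = t := by
  simp [innerAct]

variable (k P)

/-- `outerAct x 1` as a linear map in `x`. -/
def outerL : P →ₗ[k] Module.End k (P ⊗[k] P) where
  toFun x := outerAct x 1
  map_add' x y := by ext; simp [outerAct, add_mul, TensorProduct.add_tmul]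
  map_smul' c x := by ext; simp [outerAct, TensorProduct.smul_tmul']

/-- `outerAct 1 y` as a linear map in `y`. -/
def outerR : P →ₗ[k] Module.End k (P ⊗[k] P) where
  toFun y := outerAct 1 y
  map_add' x y := by ext; simp [outerAct, mul_add, TensorProduct.tmul_add]
  map_smul' c x := by ext; simp [outerAct]

/-- `innerAct x 1` as a linear map in `x`. -/
def innerL : P →ₗ[k] Module.End k (P ⊗[k] P) where
  toFun x := innerAct x 1
  map_add' x y := by ext; simp [innerAct, add_mul, TensorProduct.tmul_add]
  map_smul' c x := by ext; simp [innerAct]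

/-- `innerAct 1 y` as a linear map in `y`. -/
def innerR : P →ₗ[k] Module.End k (P ⊗[k] P) where
  toFun y := innerAct 1 y
  map_add' x y := by ext; simp [innerAct, mul_add, TensorProduct.add_tmul]
  map_smul' c x := by ext; simp [innerAct, TensorProduct.smul_tmul']

variable {Q : Type*} [Ring Q] [Algebra k Q]

variable {k P} in
theorem map_outerAct (f : Q →ₐ[k] P) (x y : Q) (t : Q ⊗[k] Q) :
    TensorProduct.map f.toLinearMap f.toLinearMap (outerAct x y t) =
      outerAct (f x) (f y) (TensorProduct.map f.toLinearMap f.toLinearMap t) := by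
  induction t with
  | zero => simp
  | tmul a b => simp [outerAct]
  | add a b ha hb => simp [ha, hb]

variable {k P} in
theorem map_innerAct (f : Q →ₐ[k] P) (x y : Q) (t : Q ⊗[k] Q) :
    TensorProduct.map f.toLinearMap f.toLinearMap (innerAct x y t) =
      innerAct (f x) (f y) (TensorProduct.map f.toLinearMap f.toLinearMap t) := by
  induction t with
  | zero => simp
  | tmul a b => simp [innerAct]
  | add a b ha hb => simp [ha, hb]

variable {k} in
/-- The derivation rule in the first argument. -/
theorem IsDoubleBracket.leibniz_left {B : Subalgebra k Q} {br : Q →ₗ[k] Q →ₗ[k] Q ⊗[k] Q}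
    (h : IsDoubleBracket B br) (a b c : Q) :
    br (a * b) c = innerAct 1 b (br a c) + innerAct a 1 (br b c) := by
  rw [h.antisymm (a * b) c, h.leibniz, h.antisymm a c, h.antisymm b c]
  simp only [map_add, comm_outerAct, map_neg]
  abel

end Actions

/-! ### Amalgamated products of algebras -/

section Amalgam

variable {k : Type*} [Field k] {C A A' : Type*} [Ring C] [Ring A] [Ring A']
  [Algebra k C] [Algebra k A] [Algebra k A']

/-- The relations defining `A *_C A'` as a quotient of the tensor algebra of `A ⊕ A'`. -/
inductive Amalg.Rel (j : C →ₐ[k] A) (j' : C →ₐ[k] A') :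
    TensorAlgebra k (A × A') → TensorAlgebra k (A × A') → Prop
  | one : Amalg.Rel j j' (TensorAlgebra.ι k (1, 0)) 1
  | mul_left (a b : A) : Amalg.Rel j j'
      (TensorAlgebra.ι k (a, 0) * TensorAlgebra.ι k (b, 0)) (TensorAlgebra.ι k (a * b, 0))
  | mul_right (a b : A') : Amalg.Rel j j'
      (TensorAlgebra.ι k (0, a) * TensorAlgebra.ι k (0, b)) (TensorAlgebra.ι k (0, a * b))
  | base (c : C) : Amalg.Rel j j' (TensorAlgebra.ι k (j c, 0)) (TensorAlgebra.ι k (0, j' c))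

/-- The free product `A *_C A'` of algebras amalgamated along `j : C → A` and `j' : C → A'`. -/
def Amalg (j : C →ₐ[k] A) (j' : C →ₐ[k] A') : Type _ := RingQuot (Amalg.Rel j j')

namespace Amalg

variable (j : C →ₐ[k] A) (j' : C →ₐ[k] A')

instance : Ring (Amalg j j') := inferInstanceAs (Ring (RingQuot (Amalg.Rel j j')))

instance : Algebra k (Amalg j j') := inferInstanceAs (Algebra k (RingQuot (Amalg.Rel j j')))

/-- The quotient map from the tensor algebra. -/
def mk : TensorAlgebra k (A × A') →ₐ[k] Amalg j j' := RingQuot.mkAlgHom k (Amalg.Rel j j')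

variable {j j'} in
theorem mk_rel {x y : TensorAlgebra k (A × A')} (h : Amalg.Rel j j' x y) :
    mk j j' x = mk j j' y :=
  RingQuot.mkAlgHom_rel k h

/-- The canonical map `A → A *_C A'`. -/
def inl : A →ₐ[k] Amalg j j' :=
  AlgHom.ofLinearMap
    ((mk j j').toLinearMap ∘ₗ TensorAlgebra.ι k ∘ₗ LinearMap.inl k A A')
    (by simpa using mk_rel (j := j) (j' := j') Rel.one)
    (fun a b ↦ by simpa using (mk_rel (j := j) (j' := j') (Rel.mul_left a b)).symm)

/-- The canonical map `A' → A *_C A'`. -/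
def inr : A' →ₐ[k] Amalg j j' :=
  AlgHom.ofLinearMap
    ((mk j j').toLinearMap ∘ₗ TensorAlgebra.ι k ∘ₗ LinearMap.inr k A A')
    (by
      have h := mk_rel (j := j) (j' := j') (Rel.base 1)
      have h' := mk_rel (j := j) (j' := j') Rel.one
      simp only [map_one] at h h'
      simpa using h.symm.trans h')
    (fun a b ↦ by simpa using (mk_rel (j := j) (j' := j') (Rel.mul_right a b)).symm)

theorem inl_base (c : C) : inl j j' (j c) = inr j j' (j' c) := by
  simpa [inl, inr] using mk_rel (j := j) (j' := j') (Rel.base c)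

variable {j j'} in
/-- `A *_C A'` is generated by the images of `A` and `A'`. -/
theorem induction {p : Amalg j j' → Prop} (hl : ∀ a, p (inl j j' a)) (hr : ∀ a, p (inr j j' a))
    (hadd : ∀ x y, p x → p y → p (x + y)) (hmul : ∀ x y, p x → p y → p (x * y))
    (x : Amalg j j') : p x := by
  obtain ⟨t, rfl⟩ : ∃ t, mk j j' t = x := RingQuot.mkAlgHom_surjective k _ x
  induction t using TensorAlgebra.induction with
  | algebraMap r =>
    have : mk j j' (algebraMap k _ r) = inl j j' (algebraMap k A r) := by
      simp only [AlgHom.commutes]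
    rw [this]; exact hl _
  | ι m =>
    have : mk j j' (TensorAlgebra.ι k m) = inl j j' m.1 + inr j j' m.2 := by
      obtain ⟨a, b⟩ := m
      simp [inl, inr, ← map_add]
    rw [this]; exact hadd _ _ (hl _) (hr _)
  | mul a b ha hb => rw [map_mul]; exact hmul _ _ ha hb
  | add a b ha hb => rw [map_add]; exact hadd _ _ ha hb

variable {j j'} in
/-- The universal property of `A *_C A'`. -/
theorem exists_lift {S : Type*} [Ring S] [Algebra k S] (f : A →ₐ[k] S) (g : A' →ₐ[k] S)
    (h : ∀ c, f (j c) = g (j' c)) :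
    ∃ F : Amalg j j' →ₐ[k] S, (∀ a, F (inl j j' a) = f a) ∧ ∀ a, F (inr j j' a) = g a := by
  let F₀ : TensorAlgebra k (A × A') →ₐ[k] S :=
    TensorAlgebra.lift k (f.toLinearMap.coprod g.toLinearMap)
  have hF₀ : ∀ ⦃x y⦄, Rel j j' x y → F₀ x = F₀ y := by
    rintro x y (_ | ⟨a, b⟩ | ⟨a, b⟩ | c) <;> simp [F₀, h]
  let F : Amalg j j' →ₐ[k] S := RingQuot.liftAlgHom k ⟨F₀, hF₀⟩
  have hF : ∀ t, F (mk j j' t) = F₀ t := fun t ↦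
    RingQuot.liftAlgHom_mkAlgHom_apply k F₀ hF₀ t
  refine ⟨F, fun a ↦ ?_, fun a ↦ ?_⟩
  · simpa [F₀, inl, inr] using hF (TensorAlgebra.ι k (a, 0))
  · simpa [F₀, inl, inr] using hF (TensorAlgebra.ι k (0, a))

variable {j j'} in
/-- A derivation of `A` into a bimodule `M` over `A *_C A'` (with commuting left and right actions
`L` and `R`) that vanishes on `C` extends uniquely to a derivation that vanishes on `A'`. -/
theorem existsUnique_derivation {M : Type*} [AddCommGroup M] [Module k M]
    (L R : Amalg j j' →ₗ[k] Module.End k M)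
    (hL1 : L 1 = 1) (hR1 : R 1 = 1) (hL : ∀ x y m, L (x * y) m = L x (L y m))
    (hR : ∀ x y m, R (x * y) m = R y (R x m)) (hLR : ∀ x y m, R y (L x m) = L x (R y m))
    (d : A →ₗ[k] M)
    (hd : ∀ a b, d (a * b) = L (inl j j' a) (d b) + R (inl j j' b) (d a))
    (hc : ∀ c, d (j c) = 0) :
    ∃! D : Amalg j j' →ₗ[k] M, (∀ x y, D (x * y) = L x (D y) + R y (D x)) ∧
      (∀ a, D (inl j j' a) = d a) ∧ ∀ a, D (inr j j' a) = 0 := by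
  have hd1 : d 1 = 0 := by simpa using hc 1
  let act (x : Amalg j j') (δ : M) : Module.End k (Amalg j j' × M) :=
    LinearMap.prod (LinearMap.mulLeft k x ∘ₗ LinearMap.fst k _ _)
      (L x ∘ₗ LinearMap.snd k _ _ + R.flip δ ∘ₗ LinearMap.fst k _ _)
  have act_apply : ∀ x δ p, act x δ p = (x * p.1, L x p.2 + R p.1 δ) := fun _ _ _ ↦ rfl
  let f : A →ₐ[k] Module.End k (Amalg j j' × M) :=
    AlgHom.ofLinearMap
      { toFun := fun a ↦ act (inl j j' a) (d a)
        map_add' := fun a b ↦ by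
          ext p <;> simp [act_apply, add_mul]
        map_smul' := fun c a ↦ by
          ext p <;> simp [act_apply] }
      (by ext p <;> simp [act_apply, hL1, hd1])
      (fun a b ↦ by
        ext p <;> simp [act_apply, hd, hL, hR, hLR, mul_assoc])
  let g : A' →ₐ[k] Module.End k (Amalg j j' × M) :=
    AlgHom.ofLinearMap
      { toFun := fun a ↦ act (inr j j' a) 0
        map_add' := fun a b ↦ by
          ext p <;> simp [act_apply, add_mul]
        map_smul' := fun c a ↦ by
          ext p <;> simp [act_apply] }
      (by ext p <;> simp [act_apply, hL1])
      (fun a b ↦ by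
        ext p <;> simp [act_apply, hL, mul_assoc])
  have hf : ∀ a, f a = act (inl j j' a) (d a) := fun _ ↦ rfl
  have hg : ∀ a, g a = act (inr j j' a) 0 := fun _ ↦ rfl
  obtain ⟨F, hFl, hFr⟩ := exists_lift (j := j) (j' := j') f g
    (fun c ↦ by rw [hf, hg, hc, inl_base])
  let D : Amalg j j' →ₗ[k] M :=
    LinearMap.snd k _ _ ∘ₗ F.toLinearMap.flip (1, 0)
  have hD : ∀ x, D x = (F x (1, 0)).2 := fun _ ↦ rfl
  have hDl : ∀ a, D (inl j j' a) = d a := fun a ↦ by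
    rw [hD, hFl, hf, act_apply]; simp [hR1]
  have hDr : ∀ a, D (inr j j' a) = 0 := fun a ↦ by
    rw [hD, hFr, hg, act_apply]; simp
  have key : ∀ x, F x = act x (D x) := by
    intro x
    induction x using Amalg.induction with
    | hl a => rw [hDl, hFl, hf]
    | hr a => rw [hDr, hFr, hg]
    | hadd x y hx hy =>
      rw [map_add, map_add, hx, hy]
      refine LinearMap.ext fun p ↦ ?_
      simp [act_apply, add_mul, add_add_add_comm]
    | hmul x y hx hy =>
      have : D (x * y) = L x (D y) + R y (D x) := by
        rw [hD, map_mul, hx, hy]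
        simp [act_apply, hR1]
      rw [map_mul, this, hx, hy]
      refine LinearMap.ext fun p ↦ ?_
      simp [act_apply, hL, hR, hLR, mul_assoc, add_assoc]
  refine ⟨D, ⟨fun x y ↦ ?_, hDl, hDr⟩, ?_⟩
  · rw [hD, map_mul, key x, key y]
    simp [act_apply, hR1]
  · rintro D' ⟨h1, h2, h3⟩
    refine LinearMap.ext fun x ↦ ?_
    induction x using Amalg.induction with
    | hl a => rw [h2, hDl]
    | hr a => rw [h3, hDr]
    | hadd x y hx hy => rw [map_add, map_add, hx, hy]
    | hmul x y hx hy =>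
      rw [h1, hx, hy, hD (x * y), map_mul, key x, key y]
      simp [act_apply, hR1]

variable {j j'} in
/-- A double derivation of `A` relative to `C` extends uniquely to a double derivation of
`A *_C A'` relative to `A'`. -/
theorem existsUnique_extDer {δ : A →ₗ[k] A ⊗[k] A} (hδ : IsDoubleDerivation j.range δ) :
    ∃! D : Amalg j j' →ₗ[k] Amalg j j' ⊗[k] Amalg j j',
      IsDoubleDerivation (inr j j').range D ∧
      ∀ a, D (inl j j' a) =
        TensorProduct.map (inl j j').toLinearMap (inl j j').toLinearMap (δ a) := by
  obtain ⟨D, ⟨h1, h2, h3⟩, h4⟩ := existsUnique_derivation (j := j) (j' := j')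
    (outerL k _) (outerR k _)
    (LinearMap.ext fun t ↦ outerAct_one_one t) (LinearMap.ext fun t ↦ outerAct_one_one t)
    (fun x y m ↦ by simpa [outerL] using outerAct_mul x y 1 1 m)
    (fun x y m ↦ by simpa [outerR] using outerAct_mul 1 1 y x m)
    (fun x y m ↦ by
      have e1 := outerAct_mul 1 x y 1 m
      have e2 := outerAct_mul x 1 1 y m
      simp only [one_mul, mul_one] at e1 e2
      exact e1.symm.trans e2)
    (TensorProduct.map (inl j j').toLinearMap (inl j j').toLinearMap ∘ₗ δ)
    (fun a b ↦ by
      simp [hδ.leibniz, map_outerAct, outerL, outerR])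
    (fun c ↦ by simp [hδ.map_base (j c) ⟨c, rfl⟩])
  refine ⟨D, ⟨⟨h1, ?_⟩, h2⟩, ?_⟩
  · rintro _ ⟨a, rfl⟩
    exact h3 a
  · rintro D' ⟨h5, h6⟩
    exact h4 D' ⟨h5.leibniz, h6, fun a ↦ h5.map_base _ ⟨a, rfl⟩⟩

variable {j j'} in
/-- A double bracket on `A` that is `C`-linear extends uniquely to a double bracket on `A *_C A'`
that is `A'`-linear. -/
theorem existsUnique_extBracket {br : A →ₗ[k] A →ₗ[k] A ⊗[k] A}
    (hbr : IsDoubleBracket j.range br) :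
    ∃! D : Amalg j j' →ₗ[k] Amalg j j' →ₗ[k] Amalg j j' ⊗[k] Amalg j j',
      IsDoubleBracket (inr j j').range D ∧
      ∀ a b, D (inl j j' a) (inl j j' b) =
        TensorProduct.map (inl j j').toLinearMap (inl j j').toLinearMap (br a b) := by
  have swap : ∀ (x y : Amalg j j') (m : Amalg j j' ⊗[k] Amalg j j'),
      outerAct 1 y (outerAct x 1 m) = outerAct x 1 (outerAct 1 y m) := fun x y m ↦ by
    have e1 := outerAct_mul 1 x y 1 m
    have e2 := outerAct_mul x 1 1 y m
    simp only [one_mul, mul_one] at e1 e2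
    exact e1.symm.trans e2
  have swap' : ∀ (x y : Amalg j j') (m : Amalg j j' ⊗[k] Amalg j j'),
      innerAct 1 y (innerAct x 1 m) = innerAct x 1 (innerAct 1 y m) := fun x y m ↦ by
    have e1 := innerAct_mul 1 x y 1 m
    have e2 := innerAct_mul x 1 1 y m
    simp only [one_mul, mul_one] at e1 e2
    exact e1.symm.trans e2
  let T := TensorProduct.map (inl j j').toLinearMap (inl j j').toLinearMap
  obtain ⟨G, ⟨g1, g2, g3⟩, -⟩ := existsUnique_derivation (j := j) (j' := j')
    (M := A →ₗ[k] Amalg j j' ⊗[k] Amalg j j')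
    (LinearMap.llcomp k A _ _ ∘ₗ outerL k _) (LinearMap.llcomp k A _ _ ∘ₗ outerR k _)
    (LinearMap.ext fun f ↦ LinearMap.ext fun a ↦ outerAct_one_one (f a))
    (LinearMap.ext fun f ↦ LinearMap.ext fun a ↦ outerAct_one_one (f a))
    (fun x y m ↦ LinearMap.ext fun a ↦ by simpa [outerL] using outerAct_mul x y 1 1 (m a))
    (fun x y m ↦ LinearMap.ext fun a ↦ by simpa [outerR] using outerAct_mul 1 1 y x (m a))
    (fun x y m ↦ LinearMap.ext fun a ↦ swap x y (m a))
    ((br.compr₂ T).flip)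
    (fun a b ↦ LinearMap.ext fun c ↦ by
      simp [hbr.leibniz, T, map_outerAct, outerL, outerR, add_comm])
    (fun c ↦ LinearMap.ext fun a ↦ by simp [hbr.base_right a (j c) ⟨c, rfl⟩])
  have g1' : ∀ x y a, G (x * y) a = outerAct x 1 (G y a) + outerAct 1 y (G x a) :=
    fun x y a ↦ LinearMap.congr_fun (g1 x y) a
  have g2' : ∀ b a, G (inl j j' b) a = T (br a b) := fun b a ↦ LinearMap.congr_fun (g2 b) a
  have g3' : ∀ b a, G (inr j j' b) a = 0 := fun b a ↦ LinearMap.congr_fun (g3 b) a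
  have g4 : ∀ y a b, G y (a * b) =
      innerAct (inl j j' a) 1 (G y b) + innerAct 1 (inl j j' b) (G y a) := by
    intro y a b
    induction y using Amalg.induction with
    | hl c => simp [g2', hbr.leibniz_left, T, map_innerAct, add_comm]
    | hr c => simp [g3']
    | hadd x y hx hy => simp only [map_add, LinearMap.add_apply, hx, hy]; abel
    | hmul x y hx hy => simp only [g1', hx, hy, map_add, outerAct_innerAct]; abel
  have g5 : ∀ y c, G y (j c) = 0 := by
    intro y c
    induction y using Amalg.induction with
    | hl b => simp [g2', hbr.base_left (j c) ⟨c, rfl⟩]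
    | hr b => simp [g3']
    | hadd x y hx hy => simp [hx, hy]
    | hmul x y hx hy => simp [g1', hx, hy]
  obtain ⟨H, ⟨h1, h2, h3⟩, -⟩ := existsUnique_derivation (j := j) (j' := j')
    (M := Amalg j j' →ₗ[k] Amalg j j' ⊗[k] Amalg j j')
    (LinearMap.llcomp k _ _ _ ∘ₗ innerL k _) (LinearMap.llcomp k _ _ _ ∘ₗ innerR k _)
    (LinearMap.ext fun f ↦ LinearMap.ext fun a ↦ innerAct_one_one (f a))
    (LinearMap.ext fun f ↦ LinearMap.ext fun a ↦ innerAct_one_one (f a))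
    (fun x y m ↦ LinearMap.ext fun a ↦ by simpa [innerL] using innerAct_mul x y 1 1 (m a))
    (fun x y m ↦ LinearMap.ext fun a ↦ by simpa [innerR] using innerAct_mul 1 1 y x (m a))
    (fun x y m ↦ LinearMap.ext fun a ↦ swap' x y (m a))
    G.flip
    (fun a b ↦ LinearMap.ext fun y ↦ g4 y a b)
    (fun c ↦ LinearMap.ext fun y ↦ g5 y c)
  have h1' : ∀ x y z, H (x * y) z = innerAct x 1 (H y z) + innerAct 1 y (H x z) :=
    fun x y z ↦ LinearMap.congr_fun (h1 x y) z
  have h2' : ∀ a y, H (inl j j' a) y = G y a := fun a y ↦ LinearMap.congr_fun (h2 a) y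
  have h3' : ∀ a y, H (inr j j' a) y = 0 := fun a y ↦ LinearMap.congr_fun (h3 a) y
  have h4 : ∀ x y z, H x (y * z) = outerAct 1 z (H x y) + outerAct y 1 (H x z) := by
    intro x y z
    induction x using Amalg.induction with
    | hl a => simp only [h2', g1', add_comm]
    | hr a => simp [h3']
    | hadd x x' hx hy => simp only [map_add, LinearMap.add_apply, hx, hy]; abel
    | hmul x x' hx hy => simp only [h1', hx, hy, map_add, outerAct_innerAct]; abel
  have h5 : ∀ x a, H x (inr j j' a) = 0 := by
    intro x a
    induction x using Amalg.induction with
    | hl b => rw [h2', g3']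
    | hr b => rw [h3']
    | hadd x y hx hy => simp [hx, hy]
    | hmul x y hx hy => simp [h1', hx, hy]
  have h6 : ∀ a b, H (inl j j' a) (inl j j' b) = T (br a b) := fun a b ↦ by rw [h2', g2']
  have hcomm : ∀ t : A ⊗[k] A, TensorProduct.comm k _ _ (T t) = T (TensorProduct.comm k A A t) := by
    intro t
    induction t with
    | zero => simp
    | tmul a b => simp [T]
    | add a b ha hb => simp [ha, hb]
  have h7 : ∀ x y, H x y = -TensorProduct.comm k _ _ (H y x) := by
    intro x
    induction x using Amalg.induction with
    | hl a =>
      intro y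
      induction y using Amalg.induction with
      | hl b => rw [h6, h6, hcomm, hbr.antisymm a b, map_neg]
      | hr b => rw [h5, h3']; simp
      | hadd x y hx hy => simp only [map_add, LinearMap.add_apply, hx, hy]; abel
      | hmul x y hx hy => simp only [h1', h4, hx, hy, map_add, map_neg, comm_innerAct]; abel
    | hr a => intro y; rw [h5, h3']; simp
    | hadd x x' hx hy => intro y; simp only [map_add, LinearMap.add_apply, hx, hy]; abel
    | hmul x x' hx hy =>
      intro y; simp only [h1', h4, hx, hy, map_add, map_neg, comm_outerAct]; abel
  refine ⟨H, ⟨⟨h7, h4, ?_, ?_⟩, h6⟩, ?_⟩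
  · rintro x _ ⟨a, rfl⟩
    exact h5 x a
  · rintro _ ⟨a, rfl⟩ y
    exact h3' a y
  · rintro D ⟨hD, hD'⟩
    refine LinearMap.ext fun x ↦ LinearMap.ext fun y ↦ ?_
    induction x using Amalg.induction with
    | hl a =>
      induction y using Amalg.induction with
      | hl b => rw [h6, hD']
      | hr b => rw [h5]; exact hD.base_right _ _ ⟨b, rfl⟩
      | hadd x y hx hy => simp only [map_add, hx, hy]
      | hmul x y hx hy => simp only [hD.leibniz, h4, hx, hy]
    | hr a => rw [h3']; exact hD.base_left _ ⟨a, rfl⟩ _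
    | hadd x x' hx hy => simp only [map_add, LinearMap.add_apply, hx, hy]
    | hmul x x' hx hy => simp only [hD.leibniz_left, h1', hx, hy, add_comm]

/-- The double derivation of `A *_C A'` relative to `A'` induced by a double derivation of `A`
relative to `C`. -/
def extDer (δ : A →ₗ[k] A ⊗[k] A) (hδ : IsDoubleDerivation j.range δ) :
    Amalg j j' →ₗ[k] Amalg j j' ⊗[k] Amalg j j' :=
  (existsUnique_extDer (j' := j') hδ).choose

/-- The `A'`-linear double bracket on `A *_C A'` induced by a `C`-linear double bracket on `A`. -/
def extBracket (br : A →ₗ[k] A →ₗ[k] A ⊗[k] A) (hbr : IsDoubleBracket j.range br) :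
    Amalg j j' →ₗ[k] Amalg j j' →ₗ[k] Amalg j j' ⊗[k] Amalg j j' :=
  (existsUnique_extBracket (j' := j') hbr).choose

end Amalg

end Amalgam

/-! ### Corner algebras -/

section Corner

variable {k : Type*} [Field k] {R : Type*} [Ring R] [Algebra k R] {ε : R}

instance cornerModule (hε : IsIdempotentElem ε) : Module k hε.Corner where
  smul c x := ⟨c • x.1, by obtain ⟨r, hr⟩ := x.2; exact ⟨c • r, by simp [← hr]⟩⟩
  one_smul x := Subtype.ext (one_smul k x.1)
  mul_smul c d x := Subtype.ext (mul_smul c d x.1)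
  smul_zero c := Subtype.ext (smul_zero c)
  smul_add c x y := Subtype.ext (smul_add c x.1 y.1)
  add_smul c d x := Subtype.ext (add_smul c d x.1)
  zero_smul x := Subtype.ext (zero_smul k x.1)

/-- `ε R ε` as a `k`-algebra with unit `ε`. -/
instance cornerAlgebra (hε : IsIdempotentElem ε) : Algebra k hε.Corner :=
  Algebra.ofModule
    (fun c x y ↦ Subtype.ext (smul_mul_assoc c x.1 y.1))
    (fun c x y ↦ Subtype.ext (mul_smul_comm c x.1 y.1))

variable (k) in
/-- The inclusion `ε R ε → R`. -/
def cornerIncl (hε : IsIdempotentElem ε) : hε.Corner →ₗ[k] R where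
  toFun x := x.1
  map_add' _ _ := rfl
  map_smul' _ _ := rfl

variable (k) in
/-- The projection `R → ε R ε`, `a ↦ ε a ε`. -/
def cornerProj (hε : IsIdempotentElem ε) : R →ₗ[k] hε.Corner where
  toFun a := ⟨ε * a * ε, a, rfl⟩
  map_add' a b := Subtype.ext (by simp [mul_add, add_mul]; rfl)
  map_smul' c a := Subtype.ext (by simp; rfl)

/-- The bracket induced on `ε R ε`: `⦃ε a ε, ε b ε⦄ = (ε ⊗ ε) ⦃a,b⦄ (ε ⊗ ε)`. -/
def cornerBracket (hε : IsIdempotentElem ε) (br : R →ₗ[k] R →ₗ[k] R ⊗[k] R) :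
    hε.Corner →ₗ[k] hε.Corner →ₗ[k] hε.Corner ⊗[k] hε.Corner :=
  (br.compl₁₂ (cornerIncl k hε) (cornerIncl k hε)).compr₂
    (TensorProduct.map (cornerProj k hε) (cornerProj k hε))

/-- For `p, q` in `R`, the map `ε a ε ↦ ε δ(a)' p ε ⊗ ε q δ(a)'' ε` on `ε R ε`, which is
`ε q δ p ε` for the inner bimodule structure on double derivations. -/
def cornerDer (hε : IsIdempotentElem ε) (q p : R) (δ : R →ₗ[k] R ⊗[k] R) :
    hε.Corner →ₗ[k] hε.Corner ⊗[k] hε.Corner :=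
  TensorProduct.map (cornerProj k hε) (cornerProj k hε) ∘ₗ innerAct q p ∘ₗ δ ∘ₗ cornerIncl k hε

end Corner

/-! ### Fusion -/

section Fusion

variable (k : Type*) [Field k] {A : Type*} [Ring A] [Algebra k A] {e₁ e₂ : A}

/-- `e₁, e₂` are orthogonal idempotents. -/
structure IsOrthogonalPair (e₁ e₂ : A) : Prop where
  idem₁ : e₁ * e₁ = e₁
  idem₂ : e₂ * e₂ = e₂
  ortho₁₂ : e₁ * e₂ = 0
  ortho₂₁ : e₂ * e₁ = 0

theorem _root_.CompleteOrthogonalIdempotents.isOrthogonalPair {I : Type*} [Fintype I] {e : I → A}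
    (he : CompleteOrthogonalIdempotents e) {i j : I} (hij : i ≠ j) :
    IsOrthogonalPair (e i) (e j) :=
  ⟨he.idem i, he.idem j, he.ortho hij, he.ortho hij.symm⟩

/-- The map `k e₁ ⊕ k e₂ ⊕ k μ → A`, `μ = 1 - e₁ - e₂`. -/
def baseToAlg (h : IsOrthogonalPair e₁ e₂) : (k × k × k) →ₐ[k] A :=
  AlgHom.ofLinearMap
    ((LinearMap.toSpanSingleton k A e₁).coprod
      ((LinearMap.toSpanSingleton k A e₂).coprod
        (LinearMap.toSpanSingleton k A (1 - e₁ - e₂))))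
    (by simp)
    (fun x y ↦ by
      simp [add_mul, mul_add, sub_mul, mul_sub, h.idem₁, h.idem₂, h.ortho₁₂, h.ortho₂₁, smul_smul,
        mul_comm])

/-- The map `k e₁ ⊕ k e₂ ⊕ k μ → Mat₂(k) ⊕ k μ`. -/
def baseToMat : (k × k × k) →ₐ[k] (Matrix (Fin 2) (Fin 2) k × k) :=
  ((Matrix.diagonalAlgHom k).comp
    (AlgHom.pi
      ![AlgHom.fst k k (k × k), (AlgHom.fst k k k).comp (AlgHom.snd k k (k × k))])).prod
    ((AlgHom.snd k k k).comp (AlgHom.snd k k (k × k)))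

/-- The extension algebra of `A` along `(e₁, e₂)`, that is
`A *_{k e₁ ⊕ k e₂ ⊕ k μ} (Mat₂(k) ⊕ k μ)`. -/
abbrev ExtAlg (h : IsOrthogonalPair e₁ e₂) : Type _ := Amalg (baseToAlg k h) (baseToMat k)

/-- The canonical map from `A` to its extension algebra. -/
def toExt (h : IsOrthogonalPair e₁ e₂) : A →ₐ[k] ExtAlg k h :=
  Amalg.inl (baseToAlg k h) (baseToMat k)

/-- The matrix unit `e_{st}` in the extension algebra (with indices in `{0, 1}`). -/
def matUnit (h : IsOrthogonalPair e₁ e₂) (s t : Fin 2) : ExtAlg k h :=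
  Amalg.inr (baseToAlg k h) (baseToMat k) (Matrix.single s t 1, 0)

theorem isIdempotentElem_eps (h : IsOrthogonalPair e₁ e₂) :
    IsIdempotentElem (1 - toExt k h e₂) :=
  IsIdempotentElem.one_sub (by
    unfold IsIdempotentElem
    rw [← map_mul, h.idem₂])

/-- The fusion algebra `ε Ā ε`, `ε = 1 - e₂`, obtained by fusing `e₂` onto `e₁`. -/
abbrev FusAlg (h : IsOrthogonalPair e₁ e₂) : Type _ := (isIdempotentElem_eps k h).Corner

/-- The image `ε a ε` in the fusion algebra of an element `a` of `A`. -/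
def toFus (h : IsOrthogonalPair e₁ e₂) (a : A) : FusAlg k h :=
  cornerProj k (isIdempotentElem_eps k h) (toExt k h a)

variable {k} in
/-- The double bracket on the fusion algebra induced by a double bracket on `A`. -/
def inducedBracket (h : IsOrthogonalPair e₁ e₂) (br : A →ₗ[k] A →ₗ[k] A ⊗[k] A)
    (hbr : IsDoubleBracket (baseToAlg k h).range br) :
    FusAlg k h →ₗ[k] FusAlg k h →ₗ[k] FusAlg k h ⊗[k] FusAlg k h :=
  cornerBracket (isIdempotentElem_eps k h)
    (Amalg.extBracket (baseToAlg k h) (baseToMat k) br hbr)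

variable {k} in
/-- The trace `Tr(δ) = ε δ ε + ε e₁₂ δ e₂₁ ε` on the fusion algebra of a double derivation of `A`,
which is first extended to the extension algebra. -/
def trDer (h : IsOrthogonalPair e₁ e₂) (δ : A →ₗ[k] A ⊗[k] A)
    (hδ : IsDoubleDerivation (baseToAlg k h).range δ) :
    FusAlg k h →ₗ[k] FusAlg k h ⊗[k] FusAlg k h :=
  cornerDer (isIdempotentElem_eps k h) 1 1
      (Amalg.extDer (baseToAlg k h) (baseToMat k) δ hδ) +
    cornerDer (isIdempotentElem_eps k h) (matUnit k h 0 1) (matUnit k h 1 0)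
      (Amalg.extDer (baseToAlg k h) (baseToMat k) δ hδ)

theorem gaugeElt_leibniz (e a b : A) :
    gaugeElt k e (a * b) = outerAct a 1 (gaugeElt k e b) + outerAct 1 b (gaugeElt k e a) := by
  simp [gaugeElt, outerAct, mul_assoc]

theorem isDoubleDerivation_gaugeElt₁ (h : IsOrthogonalPair e₁ e₂) :
    IsDoubleDerivation (baseToAlg k h).range (gaugeElt k e₁) where
  leibniz := gaugeElt_leibniz k e₁
  map_base := by
    rintro _ ⟨c, rfl⟩
    simp [baseToAlg, gaugeElt, mul_add, add_mul, sub_mul, mul_sub, h.idem₁, h.ortho₁₂, h.ortho₂₁]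

theorem isDoubleDerivation_gaugeElt₂ (h : IsOrthogonalPair e₁ e₂) :
    IsDoubleDerivation (baseToAlg k h).range (gaugeElt k e₂) where
  leibniz := gaugeElt_leibniz k e₂
  map_base := by
    rintro _ ⟨c, rfl⟩
    simp [baseToAlg, gaugeElt, mul_add, add_mul, sub_mul, mul_sub, h.idem₂, h.ortho₁₂, h.ortho₂₁]

/-- The double bracket `⦃-,-⦄_fus` on the fusion algebra, defined by the bivector
`-1/2 Tr(E₁) Tr(E₂)`. -/
def fusBracket (h : IsOrthogonalPair e₁ e₂) :
    FusAlg k h →ₗ[k] FusAlg k h →ₗ[k] FusAlg k h ⊗[k] FusAlg k h :=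
  (-(1 / 2) : k) • bivectorBracket
    (trDer h (gaugeElt k e₁) (isDoubleDerivation_gaugeElt₁ k h))
    (trDer h (gaugeElt k e₂) (isDoubleDerivation_gaugeElt₂ k h))

variable {k} in
/-- The subalgebra `k e₁ ⊕ k e₂ ⊕ k μ` lies in `B = ⨁ k e_s`, so `B`-linearity implies linearity
over it. -/
theorem IsDoubleQuasiPoisson.isDoubleBracket_base {I : Type*} [Fintype I] {e : I → A}
    {br : A →ₗ[k] A →ₗ[k] A ⊗[k] A} (hbr : IsDoubleQuasiPoisson e br) {i j : I} (hij : i ≠ j) :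
    IsDoubleBracket (baseToAlg k (hbr.idem.isOrthogonalPair hij)).range br := by
  have hle : (baseToAlg k (hbr.idem.isOrthogonalPair hij)).range ≤
      Algebra.adjoin k (Set.range e) := by
    rintro _ ⟨c, rfl⟩
    have hm : ∀ s, e s ∈ Algebra.adjoin k (Set.range e) := fun s ↦
      Algebra.subset_adjoin ⟨s, rfl⟩
    simp only [baseToAlg]
    refine add_mem (Subalgebra.smul_mem _ (hm i) _) (add_mem (Subalgebra.smul_mem _ (hm j) _)
      (Subalgebra.smul_mem _ (sub_mem (sub_mem (one_mem _) (hm i)) (hm j)) _))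
  exact ⟨hbr.bracket.antisymm, hbr.bracket.leibniz, fun a b hb ↦ hbr.bracket.base_right a b (hle hb),
    fun b hb a ↦ hbr.bracket.base_left b (hle hb) a⟩

end Fusion

end DoubleBrackets

end

open scoped TensorProduct

noncomputable section

namespace DoubleBrackets

/-! ### Elementary tensors and the cyclic permutation. -/

section General

variable {k : Type*} [Field k] {R : Type*} [Ring R] [Algebra k R]

/-! Everything is computed in the extension algebra `Ā`, where the matrix units are available, and
restricted to the corner `A^f = εĀε` only at the end. Write `F = e₁₂ E₂ e₂₁`, where `E₁`, `E₂` also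
denote the extensions to `Ā`. Since `E₁` takes values in `Ā e₁ ⊗ e₁ Ā` and `E₂` in `Ā e₂ ⊗ e₂ Ā`,
the double derivations `Tr(E₁)` and `Tr(E₂)` are the restrictions of `E₁` and `F` to the corner.
Hence the fused bracket is the restriction of `br - 1/2 P` (`extFusBracket`), where `br` is the
extended bracket and `P` is the bracket of the bivector `E₁F` (`map_fusIncl_bracket`).

The triple bracket of `br - 1/2 P` and the trivector brackets to be compared with it are cyclic and
are derivations in each argument that vanish on `Mat₂(k) ⊕ kμ`. So it suffices to compare them on
the image of `A` (`Amalg.isTripleDerivation_eq_zero`). There `E₁` and `F` are explicit, and two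
computations remain: the terms mixing `br` and `P` cancel
(`IsMatUnits.tripleBracket_add_bivectorBracket`), and the triple bracket of `P` is that of the
trivector `E₁²F + E₁F²` (`IsMatUnits.tripleBracket_bivectorBracket`).

Trivector brackets do not change when the three factors are permuted cyclically, so `(E₁+F)³ = E₁³ +
F³ + 3(E₁²F + E₁F²)`. The coefficient `(-1/2)² = 3/12` turns the contribution of `P` into `1/12
((E₁+F)³ - E₁³ - F³)`. On `A` the trivector brackets of `F³` and `E₂³` agree. Adding this to `1/12 ∑
E_s³` therefore removes `E₂³` and replaces `E₁³` by `(E₁+F)³`. Finally `E₁+F` is the inner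
derivation of the matrix Casimir element `e₁ ⊗ e₁ + e₂₁ ⊗ e₁₂`, and on the corner, where `x e₂₁ = 0
= e₁₂ x`, it is the gauge element of `e₁` (`innerDer_casimir_fusIncl`). -/

theorem outerAct_tmul (b c x y : R) :
    outerAct (k := k) b c (x ⊗ₜ y) = (b * x) ⊗ₜ (y * c) := rfl

theorem innerAct_tmul (b c x y : R) :
    innerAct (k := k) b c (x ⊗ₜ y) = (x * c) ⊗ₜ (b * y) := rfl

theorem cyc_tmul (x y z : R) :
    cyc (k := k) ((x ⊗ₜ y) ⊗ₜ z) = (z ⊗ₜ x) ⊗ₜ y := rfl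

theorem outer₃_tmul (x y z : R) (w : R ⊗[k] R) :
    outer₃ (x ⊗ₜ y) (w ⊗ₜ z) = outerAct x 1 w ⊗ₜ (z * y) := by
  simp [outer₃, outerAct, LinearMap.rTensor]
  rfl

theorem outer₃_tmul_tmul (x y a b c : R) :
    outer₃ (k := k) (x ⊗ₜ y) ((a ⊗ₜ b) ⊗ₜ c) = ((x * a) ⊗ₜ b) ⊗ₜ (c * y) := by
  rw [outer₃_tmul, outerAct_tmul, mul_one]

theorem outerAct_swap (x y : R) (t : R ⊗[k] R) :
    outerAct 1 y (outerAct x 1 t) = outerAct x 1 (outerAct 1 y t) := by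
  rw [← outerAct_mul, ← outerAct_mul]; simp

theorem cyc_cyc_cyc (t : (R ⊗[k] R) ⊗[k] R) : cyc (cyc (cyc t)) = t := by
  have : (cyc ∘ₗ cyc ∘ₗ cyc : (R ⊗[k] R) ⊗[k] R →ₗ[k] _) = LinearMap.id := by
    ext x y z; rfl
  exact LinearMap.congr_fun this t

/-! ### Cyclicity and derivation property of triple brackets -/

theorem tripleBracket_cyc (br : R →ₗ[k] R →ₗ[k] R ⊗[k] R) (a b c : R) :
    tripleBracket br a b c = cyc (tripleBracket br b c a) := by
  simp only [tripleBracket, map_add, cyc_cyc_cyc]; abel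

theorem trivectorBracket_cyc (δ₁ δ₂ δ₃ : R →ₗ[k] R ⊗[k] R) (a b c : R) :
    trivectorBracket δ₁ δ₂ δ₃ a b c = cyc (trivectorBracket δ₁ δ₂ δ₃ b c a) := by
  simp only [trivectorBracket, map_add, cyc_cyc_cyc]; abel

theorem contract₃_add_right (s t u v : R ⊗[k] R) :
    contract₃ s t (u + v) = contract₃ s t u + contract₃ s t v := by
  simp [contract₃]

theorem contract₃_add_left (s t u v : R ⊗[k] R) :
    contract₃ (s + t) u v = contract₃ s u v + contract₃ t u v := by
  simp [contract₃, TensorProduct.add_tmul]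

theorem contract₃_add_mid (s t u v : R ⊗[k] R) :
    contract₃ s (t + u) v = contract₃ s t v + contract₃ s u v := by
  simp [contract₃, TensorProduct.tmul_add]

/-- The three legs of a contraction are joined in a ring, so rotating the output amounts to rotating
the inputs. The cyclic sum over arguments in a trivector bracket thereby becomes one over the
derivations, with the arguments left in place. -/
theorem cyc_contract₃ (t₁ t₂ t₃ : R ⊗[k] R) :
    cyc (contract₃ t₁ t₂ t₃) = contract₃ t₃ t₁ t₂ := by
  induction t₁ with
  | zero => simp [contract₃]
  | add x y hx hy => simp only [contract₃_add_left, contract₃_add_mid, map_add, hx, hy]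
  | tmul x₁ y₁ =>
  induction t₂ with
  | zero => simp [contract₃]
  | add x y hx hy => simp only [contract₃_add_mid, contract₃_add_right, map_add, hx, hy]
  | tmul x₂ y₂ =>
  induction t₃ with
  | zero => simp [contract₃]
  | add x y hx hy => simp only [contract₃_add_right, contract₃_add_left, map_add, hx, hy]
  | tmul x₃ y₃ => simp only [contract₃_tmul, cyc_tmul]

/-- The trivector bracket as a sum over the cyclic permutations of the derivations. -/
theorem trivectorBracket_eq (δ₁ δ₂ δ₃ : R →ₗ[k] R ⊗[k] R) (a b c : R) :
    trivectorBracket δ₁ δ₂ δ₃ a b c = contract₃ (δ₁ a) (δ₂ b) (δ₃ c) +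
      contract₃ (δ₂ a) (δ₃ b) (δ₁ c) + contract₃ (δ₃ a) (δ₁ b) (δ₂ c) := by
  simp only [trivectorBracket, cyc_contract₃]; abel

theorem outer₃_mul (x x' y y' : R) (t : (R ⊗[k] R) ⊗[k] R) :
    outer₃ ((x * x') ⊗ₜ (y' * y)) t = outer₃ (x ⊗ₜ y) (outer₃ (x' ⊗ₜ y') t) := by
  induction t with
  | zero => simp
  | add x y hx hy => simp only [map_add, hx, hy]
  | tmul w z =>
    simp only [outer₃_tmul, ← outerAct_mul, mul_assoc, mul_one]

theorem contract₃_outerAct (s t u : R ⊗[k] R) (x y : R) :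
    contract₃ s t (outerAct x y u) = outer₃ (x ⊗ₜ y) (contract₃ s t u) := by
  induction u with
  | zero => simp [contract₃]
  | add u v hu hv => simp only [contract₃_add_right, map_add, hu, hv]
  | tmul a b => rw [outerAct_tmul]; exact outer₃_mul _ _ _ _ _

/-- In the form `trivectorBracket_eq` the last argument always enters the third slot of `contract₃`,
whose factors end up on the outer left and outer right of the result. -/
theorem trivectorBracket_leibniz {B : Subalgebra k R} {δ₁ δ₂ δ₃ : R →ₗ[k] R ⊗[k] R}
    (h₁ : IsDoubleDerivation B δ₁) (h₂ : IsDoubleDerivation B δ₂) (h₃ : IsDoubleDerivation B δ₃)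
    (a b c d : R) :
    trivectorBracket δ₁ δ₂ δ₃ a b (c * d) =
      outer₃ (1 ⊗ₜ d) (trivectorBracket δ₁ δ₂ δ₃ a b c) +
        outer₃ (c ⊗ₜ 1) (trivectorBracket δ₁ δ₂ δ₃ a b d) := by
  simp only [trivectorBracket_eq, h₁.leibniz, h₂.leibniz, h₃.leibniz, contract₃_add_right,
    contract₃_outerAct, map_add]
  abel

theorem trivectorBracket_add_right (δ₁ δ₂ δ₃ : R →ₗ[k] R ⊗[k] R) (a b c d : R) :
    trivectorBracket δ₁ δ₂ δ₃ a b (c + d) =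
      trivectorBracket δ₁ δ₂ δ₃ a b c + trivectorBracket δ₁ δ₂ δ₃ a b d := by
  simp only [trivectorBracket_eq, map_add, contract₃_add_right]; abel

theorem tripleBracket_add_right (br : R →ₗ[k] R →ₗ[k] R ⊗[k] R) (a b c d : R) :
    tripleBracket br a b (c + d) = tripleBracket br a b c + tripleBracket br a b d := by
  simp only [tripleBracket, map_add, LinearMap.add_apply, LinearMap.rTensor_add]; abel

theorem cyc_tmul_mul (w : R ⊗[k] R) (x y : R) :
    cyc (w ⊗ₜ (x * y)) = outer₃ (x ⊗ₜ 1) (cyc (w ⊗ₜ y)) := by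
  induction w with
  | zero => simp
  | add u v hu hv => simp only [TensorProduct.add_tmul, map_add, hu, hv]
  | tmul a b => simp only [cyc_tmul, outer₃_tmul_tmul, mul_one]

theorem cyc_outerAct_tmul (w : R ⊗[k] R) (x y : R) :
    cyc (outerAct 1 x w ⊗ₜ y) = outer₃ (1 ⊗ₜ x) (cyc (w ⊗ₜ y)) := by
  induction w with
  | zero => simp
  | add u v hu hv => simp only [TensorProduct.add_tmul, map_add, hu, hv]
  | tmul a b => simp only [cyc_tmul, outerAct_tmul, outer₃_tmul_tmul, one_mul]

theorem cyc_cyc_innerAct_tmul (w : R ⊗[k] R) (x y z : R) :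
    cyc (cyc (innerAct x y w ⊗ₜ z)) = outer₃ (x ⊗ₜ y) (cyc (cyc (w ⊗ₜ z))) := by
  induction w with
  | zero => simp
  | add u v hu hv => simp only [TensorProduct.add_tmul, map_add, hu, hv]
  | tmul a b => simp only [cyc_tmul, innerAct_tmul, outer₃_tmul_tmul]

/-- The operation `x ⊗ y, z ⊗ w ↦ x ⊗ y z ⊗ w` in two guises. -/
theorem rTensor_outerR_comm (t w : R ⊗[k] R) :
    LinearMap.rTensor R ((outerR k R).flip (TensorProduct.comm k R R t)) w =
      cyc (LinearMap.rTensor R ((outerL k R).flip w) t) := by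
  induction t with
  | zero => simp
  | add u v hu hv => simp only [map_add, LinearMap.rTensor_add, LinearMap.add_apply, hu, hv]
  | tmul a b =>
  induction w with
  | zero => simp
  | add u v hu hv =>
    simp only [map_add, LinearMap.rTensor_tmul, LinearMap.add_apply,
      TensorProduct.add_tmul] at hu hv ⊢
    rw [hu, hv]
  | tmul c d => simp [outerR, outerL, outerAct, cyc_tmul]

/-- A triple bracket is a derivation even though it is quadratic in the bracket: the terms in which
the two brackets each differentiate one of `c` and `d` cancel. -/
theorem IsDoubleBracket.tripleBracket_leibniz {B : Subalgebra k R}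
    {br : R →ₗ[k] R →ₗ[k] R ⊗[k] R} (h : IsDoubleBracket B br) (a b c d : R) :
    tripleBracket br a b (c * d) =
      outer₃ (1 ⊗ₜ d) (tripleBracket br a b c) + outer₃ (c ⊗ₜ 1) (tripleBracket br a b d) := by
  have h1 (t : R ⊗[k] R) : (br a).rTensor R (outerAct 1 d t) =
      outer₃ (1 ⊗ₜ d) ((br a).rTensor R t) := by
    induction t with
    | zero => simp
    | add u v hu hv => simp only [map_add, hu, hv]
    | tmul x y => simp [outerAct_tmul, outer₃_tmul, outerAct_one_one]
  have h2 (t : R ⊗[k] R) : (br a).rTensor R (outerAct c 1 t) =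
      outer₃ (c ⊗ₜ 1) ((br a).rTensor R t) +
        LinearMap.rTensor R ((outerR k R).flip (br a c)) t := by
    induction t with
    | zero => simp
    | add u v hu hv => simp only [map_add, hu, hv]; abel
    | tmul x y =>
      simp only [outerAct_tmul, LinearMap.rTensor_tmul, h.leibniz, outer₃_tmul, mul_one,
        TensorProduct.add_tmul, outerR, LinearMap.flip_apply, LinearMap.coe_mk, AddHom.coe_mk]
      abel
  have h3 (t : R ⊗[k] R) : cyc ((br b).rTensor R (innerAct 1 d t)) =
      outer₃ (1 ⊗ₜ d) (cyc ((br b).rTensor R t)) +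
        cyc (LinearMap.rTensor R ((outerL k R).flip (br b d)) t) := by
    induction t with
    | zero => simp
    | add u v hu hv => simp only [map_add, hu, hv]; abel
    | tmul x y =>
      simp only [innerAct_tmul, LinearMap.rTensor_tmul, h.leibniz, one_mul,
        TensorProduct.add_tmul, outerL, LinearMap.flip_apply, LinearMap.coe_mk, AddHom.coe_mk,
        map_add, cyc_outerAct_tmul]
  have h4 (t : R ⊗[k] R) : cyc ((br b).rTensor R (innerAct c 1 t)) =
      outer₃ (c ⊗ₜ 1) (cyc ((br b).rTensor R t)) := by
    induction t with
    | zero => simp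
    | add u v hu hv => simp only [map_add, hu, hv]
    | tmul x y => simp only [innerAct_tmul, LinearMap.rTensor_tmul, mul_one, cyc_tmul_mul]
  have h5 (t : R ⊗[k] R) : cyc (cyc ((br (c * d)).rTensor R t)) =
      outer₃ (1 ⊗ₜ d) (cyc (cyc ((br c).rTensor R t))) +
        outer₃ (c ⊗ₜ 1) (cyc (cyc ((br d).rTensor R t))) := by
    induction t with
    | zero => simp
    | add u v hu hv => simp only [map_add, hu, hv]; abel
    | tmul x y =>
      simp only [LinearMap.rTensor_tmul, h.leibniz_left, TensorProduct.add_tmul, map_add,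
        cyc_cyc_innerAct_tmul]
  -- The Leibniz rule leaves two stray terms, one built from `br a c` and `br b d` in the first
  -- summand, one from `br c a` and `br b d` in the second. Antisymmetry makes them opposite.
  have h6 := rTensor_outerR_comm (br c a) (br b d)
  rw [← neg_eq_iff_eq_neg.mpr (h.antisymm a c)] at h6
  simp only [map_neg, LinearMap.rTensor_neg, LinearMap.neg_apply] at h6
  simp only [tripleBracket, h.leibniz b c d, h.leibniz_left c d a, map_add, h1, h2, h3, h4, h5,
    ← h6]
  abel

theorem IsDoubleBracket.tripleBracket_base {B : Subalgebra k R}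
    {br : R →ₗ[k] R →ₗ[k] R ⊗[k] R} (h : IsDoubleBracket B br) (a b : R) {c : R} (hc : c ∈ B) :
    tripleBracket br a b c = 0 := by
  have : br c = 0 := LinearMap.ext (h.base_left c hc)
  simp [tripleBracket, h.base_right b c hc, this]

theorem trivectorBracket_base {B : Subalgebra k R} {δ₁ δ₂ δ₃ : R →ₗ[k] R ⊗[k] R}
    (h₁ : IsDoubleDerivation B δ₁) (h₂ : IsDoubleDerivation B δ₂) (h₃ : IsDoubleDerivation B δ₃)
    (a b : R) {c : R} (hc : c ∈ B) : trivectorBracket δ₁ δ₂ δ₃ a b c = 0 := by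
  simp [trivectorBracket_eq, contract₃, h₁.map_base c hc, h₂.map_base c hc, h₃.map_base c hc]

/-! ### Sums, multiples and bivector brackets -/

theorem IsDoubleBracket.add {B : Subalgebra k R} {br br' : R →ₗ[k] R →ₗ[k] R ⊗[k] R}
    (h : IsDoubleBracket B br) (h' : IsDoubleBracket B br') : IsDoubleBracket B (br + br') where
  antisymm a b := by
    simp only [LinearMap.add_apply, map_add, h.antisymm a b, h'.antisymm a b]; abel
  leibniz a b c := by
    simp only [LinearMap.add_apply, map_add, h.leibniz, h'.leibniz]; abel
  base_right a b hb := by simp [h.base_right a b hb, h'.base_right a b hb]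
  base_left b hb a := by simp [h.base_left b hb a, h'.base_left b hb a]

theorem IsDoubleBracket.smul {B : Subalgebra k R} {br : R →ₗ[k] R →ₗ[k] R ⊗[k] R}
    (h : IsDoubleBracket B br) (r : k) : IsDoubleBracket B (r • br) where
  antisymm a b := by simp only [LinearMap.smul_apply, map_smul, h.antisymm a b, smul_neg]
  leibniz a b c := by simp only [LinearMap.smul_apply, map_smul, h.leibniz, smul_add]
  base_right a b hb := by simp [h.base_right a b hb]
  base_left b hb a := by simp [h.base_left b hb a]

theorem comm_contract₂ (s t : R ⊗[k] R) :
    TensorProduct.comm k R R (contract₂ s t) = contract₂ t s := by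
  induction s with
  | zero => simp
  | add u v hu hv => simp only [map_add, LinearMap.add_apply, hu, hv]
  | tmul a b =>
  induction t with
  | zero => simp
  | add u v hu hv => simp only [map_add, LinearMap.add_apply, hu, hv]
  | tmul c d => simp [contract₂_tmul]

theorem contract₂_outerAct (s t : R ⊗[k] R) (x y : R) :
    contract₂ s (outerAct x y t) = outerAct x y (contract₂ s t) := by
  induction s with
  | zero => simp
  | add u v hu hv => simp only [map_add, LinearMap.add_apply, hu, hv]
  | tmul a b =>
  induction t with
  | zero => simp
  | add u v hu hv => simp only [map_add, hu, hv]
  | tmul c d => simp [contract₂_tmul, outerAct_tmul, mul_assoc]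

theorem bivectorBracket_apply (δ₁ δ₂ : R →ₗ[k] R ⊗[k] R) (a b : R) :
    bivectorBracket δ₁ δ₂ a b = contract₂ (δ₁ a) (δ₂ b) - contract₂ (δ₂ a) (δ₁ b) := rfl

theorem isDoubleBracket_bivectorBracket {B : Subalgebra k R} {δ₁ δ₂ : R →ₗ[k] R ⊗[k] R}
    (h₁ : IsDoubleDerivation B δ₁) (h₂ : IsDoubleDerivation B δ₂) :
    IsDoubleBracket B (bivectorBracket δ₁ δ₂) where
  antisymm a b := by simp only [bivectorBracket_apply, map_sub, comm_contract₂]; abel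
  leibniz a b c := by
    simp only [bivectorBracket_apply, h₁.leibniz, h₂.leibniz, map_add, contract₂_outerAct, map_sub]
    abel
  base_right a b hb := by simp [bivectorBracket_apply, h₁.map_base b hb, h₂.map_base b hb]
  base_left b hb a := by simp [bivectorBracket_apply, h₁.map_base b hb, h₂.map_base b hb]

/-! ### Compatibility with multiplicative maps -/

variable {Q : Type*} [Ring Q] [Algebra k Q]

/-- The map induced on third tensor powers. -/
def map₃ (f : Q →ₗ[k] R) : (Q ⊗[k] Q) ⊗[k] Q →ₗ[k] (R ⊗[k] R) ⊗[k] R :=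
  TensorProduct.map (TensorProduct.map f f) f

theorem map₃_cyc (f : Q →ₗ[k] R) (t : (Q ⊗[k] Q) ⊗[k] Q) :
    map₃ f (cyc t) = cyc (map₃ f t) := by
  have : map₃ f ∘ₗ cyc = cyc ∘ₗ map₃ f := by ext x y z; rfl
  exact LinearMap.congr_fun this t

theorem map₃_tripleBracket (f : Q →ₗ[k] R) {br : Q →ₗ[k] Q →ₗ[k] Q ⊗[k] Q}
    {br' : R →ₗ[k] R →ₗ[k] R ⊗[k] R}
    (h : ∀ x y, TensorProduct.map f f (br x y) = br' (f x) (f y)) (a b c : Q) :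
    map₃ f (tripleBracket br a b c) = tripleBracket br' (f a) (f b) (f c) := by
  have key (x : Q) (t : Q ⊗[k] Q) : map₃ f ((br x).rTensor Q t) =
      (br' (f x)).rTensor R (TensorProduct.map f f t) := by
    induction t with
    | zero => simp
    | add u v hu hv => simp only [map_add, hu, hv]
    | tmul y z => simp [map₃, h]
  simp only [tripleBracket, map_add, map₃_cyc, key, h]

/-- Only multiplicativity of `f` is required, not `f 1 = 1`, so that this covers the inclusion of a
corner, which sends the unit to `ε`. -/
theorem map_contract₂ (f : Q →ₗ[k] R) (hf : ∀ x y, f (x * y) = f x * f y) (s t : Q ⊗[k] Q) :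
    TensorProduct.map f f (contract₂ s t) =
      contract₂ (TensorProduct.map f f s) (TensorProduct.map f f t) := by
  induction s with
  | zero => simp
  | add u v hu hv => simp only [map_add, LinearMap.add_apply, hu, hv]
  | tmul a b =>
  induction t with
  | zero => simp
  | add u v hu hv => simp only [map_add, hu, hv]
  | tmul c d => simp [contract₂_tmul, hf]

theorem map₃_contract₃ (f : Q →ₗ[k] R) (hf : ∀ x y, f (x * y) = f x * f y)
    (s t u : Q ⊗[k] Q) :
    map₃ f (contract₃ s t u) = contract₃ (TensorProduct.map f f s) (TensorProduct.map f f t)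
      (TensorProduct.map f f u) := by
  induction s with
  | zero => simp [contract₃]
  | add u v hu hv => simp only [map_add, contract₃_add_left, hu, hv]
  | tmul a b =>
  induction t with
  | zero => simp [contract₃]
  | add u v hu hv => simp only [map_add, contract₃_add_mid, hu, hv]
  | tmul c d =>
  induction u with
  | zero => simp [contract₃]
  | add u v hu hv => simp only [map_add, contract₃_add_right, hu, hv]
  | tmul c d => simp [contract₃_tmul, map₃, hf]

theorem map₃_trivectorBracket (f : Q →ₗ[k] R) (hf : ∀ x y, f (x * y) = f x * f y)
    {δ : Q →ₗ[k] Q ⊗[k] Q} {δ' : R →ₗ[k] R ⊗[k] R}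
    (h : ∀ x, TensorProduct.map f f (δ x) = δ' (f x)) (a b c : Q) :
    map₃ f (trivectorBracket δ δ δ a b c) = trivectorBracket δ' δ' δ' (f a) (f b) (f c) := by
  simp only [trivectorBracket_eq, map_add, map₃_contract₃ f hf, h]

theorem map_gaugeElt (f : Q →ₗ[k] R) (hf : ∀ x y, f (x * y) = f x * f y) (e x : Q) :
    TensorProduct.map f f (gaugeElt k e x) = gaugeElt k (f e) (f x) := by
  simp [gaugeElt, hf]

/-! ### Inner double derivations -/

variable (k R) in
/-- The inner double derivation `x ↦ x Δ - Δ x`. -/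
def innerDer (Δ : R ⊗[k] R) : R →ₗ[k] R ⊗[k] R :=
  (outerL k R).flip Δ - (outerR k R).flip Δ

theorem innerDer_apply (Δ : R ⊗[k] R) (x : R) :
    innerDer k R Δ x = outerAct x 1 Δ - outerAct 1 x Δ := rfl

theorem innerDer_leibniz (Δ : R ⊗[k] R) (a b : R) :
    innerDer k R Δ (a * b) =
      outerAct a 1 (innerDer k R Δ b) + outerAct 1 b (innerDer k R Δ a) := by
  have h1 := outerAct_mul a b 1 1 Δ
  have h2 := outerAct_mul 1 1 b a Δ
  rw [mul_one] at h1 h2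
  simp only [innerDer_apply, map_sub, h1, h2, outerAct_swap]
  abel

theorem innerDer_tmul_self (e : R) : innerDer k R (e ⊗ₜ e) = gaugeElt k e := by
  ext x; simp [innerDer_apply, outerAct_tmul, gaugeElt]

end General

/-! ### Brackets of the bivector `E₁F` in terms of matrix units. -/

section MatrixUnits

variable {k : Type*} [Field k] {R : Type*} [Ring R] [Algebra k R]

theorem contract₃_sub_right (s t u v : R ⊗[k] R) :
    contract₃ s t (u - v) = contract₃ s t u - contract₃ s t v := by
  simp [contract₃]

theorem contract₃_sub_left (s t u v : R ⊗[k] R) :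
    contract₃ (s - t) u v = contract₃ s u v - contract₃ t u v := by
  simp [contract₃, TensorProduct.sub_tmul]

theorem contract₃_sub_mid (s t u v : R ⊗[k] R) :
    contract₃ s (t - u) v = contract₃ s t v - contract₃ s u v := by
  simp [contract₃, TensorProduct.tmul_sub]

/-- `e = e₁₁`, `u = e₁₂`, `v = e₂₁` satisfy the relations of the matrix units of size two. -/
structure IsMatUnits (e u v : R) : Prop where
  uv : u * v = e
  uu : u * u = 0
  vv : v * v = 0
  eu : e * u = u
  ve : v * e = v
  ee : e * e = e

variable {e u v : R}

/-- The idempotent `e` disappears through `v e = v` and `e u = u`. Each leg of each of the eight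
terms is then a word in `u`, `v`, `b`, `c`, to which the Leibniz rule applies again. -/
theorem IsMatUnits.bivectorBracket_apply (hm : IsMatUnits e u v) {δ₁ δ₂ : R →ₗ[k] R ⊗[k] R}
    {b c : R}
    (h₁b : δ₁ b = (b * e) ⊗ₜ e - e ⊗ₜ (e * b)) (h₁c : δ₁ c = (c * e) ⊗ₜ e - e ⊗ₜ (e * c))
    (h₂b : δ₂ b = (b * v) ⊗ₜ u - v ⊗ₜ (u * b)) (h₂c : δ₂ c = (c * v) ⊗ₜ u - v ⊗ₜ (u * c)) :
    bivectorBracket δ₁ δ₂ b c =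
      (c * v) ⊗ₜ (b * u) - v ⊗ₜ (b * (u * c)) - (c * (v * b)) ⊗ₜ u + (v * b) ⊗ₜ (u * c) -
      ((c * u) ⊗ₜ (b * v) - u ⊗ₜ (b * (v * c)) - (c * (u * b)) ⊗ₜ v + (u * b) ⊗ₜ (v * c)) := by
  have r1 (x : R) : v * (e * x) = v * x := by rw [← mul_assoc, hm.ve]
  have r2 (x : R) : e * (u * x) = u * x := by rw [← mul_assoc, hm.eu]
  simp only [DoubleBrackets.bivectorBracket_apply, h₁b, h₁c, h₂b, h₂c, map_sub,
    LinearMap.sub_apply, contract₂_tmul, mul_assoc, hm.ve, hm.eu, r1, r2]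
  abel

set_option maxRecDepth 10000 in
-- The inner bracket has words in `u`, `v` and elements of `S` as legs. The outer one kills `u` and
-- `v`, so only brackets of elements of `S` survive and the explicit formula applies a second time.
-- Both sides then reduce by the relations of matrix units to the same sum of elementary tensors.
theorem IsMatUnits.tripleBracket_bivectorBracket (hm : IsMatUnits e u v) {B : Subalgebra k R}
    {δ₁ δ₂ : R →ₗ[k] R ⊗[k] R} (hδ₁ : IsDoubleDerivation B δ₁) (hδ₂ : IsDoubleDerivation B δ₂)
    (hu : u ∈ B) (hv : v ∈ B) {S : Set R}
    (h₁ : ∀ x ∈ S, δ₁ x = (x * e) ⊗ₜ e - e ⊗ₜ (e * x))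
    (h₂ : ∀ x ∈ S, δ₂ x = (x * v) ⊗ₜ u - v ⊗ₜ (u * x))
    {a b c : R} (ha : a ∈ S) (hb : b ∈ S) (hc : c ∈ S) :
    tripleBracket (bivectorBracket δ₁ δ₂) a b c =
      trivectorBracket δ₁ δ₁ δ₂ a b c + trivectorBracket δ₁ δ₂ δ₂ a b c := by
  have hP := isDoubleBracket_bivectorBracket hδ₁ hδ₂
  have hPS {x y : R} (hx : x ∈ S) (hy : y ∈ S) :=
    hm.bivectorBracket_apply (h₁ x hx) (h₁ y hy) (h₂ x hx) (h₂ y hy)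
  have hPu (x : R) := hP.base_right x u hu
  have hPv (x : R) := hP.base_right x v hv
  have ruv (x : R) : u * (v * x) = e * x := by rw [← mul_assoc, hm.uv]
  have ruu (x : R) : u * (u * x) = 0 := by rw [← mul_assoc, hm.uu, zero_mul]
  have rvv (x : R) : v * (v * x) = 0 := by rw [← mul_assoc, hm.vv, zero_mul]
  have reu (x : R) : e * (u * x) = u * x := by rw [← mul_assoc, hm.eu]
  have rve (x : R) : v * (e * x) = v * x := by rw [← mul_assoc, hm.ve]
  have ree (x : R) : e * (e * x) = e * x := by rw [← mul_assoc, hm.ee]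
  simp only [tripleBracket, trivectorBracket_eq]
  rw [hPS hb hc, hPS hc ha, hPS ha hb]
  simp only [map_add, map_sub, LinearMap.rTensor_tmul, hP.leibniz, hPu, hPv, map_zero, add_zero,
    zero_add]
  rw [hPS hb hc, hPS hc ha, hPS ha hb, hPS hc hb, hPS ha hc, hPS hb ha]
  simp only [h₁ _ ha, h₁ _ hb, h₁ _ hc, h₂ _ ha, h₂ _ hb, h₂ _ hc]
  simp only [map_add, map_sub, outerAct_tmul, TensorProduct.add_tmul, TensorProduct.sub_tmul,
    cyc_tmul, contract₃_sub_right, contract₃_sub_left, contract₃_sub_mid,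
    contract₃_tmul, one_mul, mul_one, mul_assoc,
    hm.uv, hm.uu, hm.vv, hm.eu, hm.ve, hm.ee, ruv, ruu, rvv, reu, rve, ree,
    mul_zero, TensorProduct.zero_tmul, TensorProduct.tmul_zero, sub_zero, zero_sub, add_zero,
    TensorProduct.neg_tmul, map_neg]
  abel

variable (u v) in
/-- The part of `⦃x, P(y, a)'⦄ ⊗ P(y, a)''` that depends on `t = ⦃x, y⦄`, for the bivector
bracket `P`. -/
def mixedLeft (a : R) (t : R ⊗[k] R) : (R ⊗[k] R) ⊗[k] R :=
  -outerAct (a * v) 1 t ⊗ₜ u + outerAct v 1 t ⊗ₜ (u * a) + outerAct (a * u) 1 t ⊗ₜ v -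
    outerAct u 1 t ⊗ₜ (v * a)

variable (u v) in
/-- The part of `⦃x, P(a, z)'⦄ ⊗ P(a, z)''` that depends on `t = ⦃z, x⦄`, for the bivector
bracket `P`. -/
def mixedRight (a : R) (t : R ⊗[k] R) : (R ⊗[k] R) ⊗[k] R :=
  -outerAct 1 v (TensorProduct.comm k R R t) ⊗ₜ (a * u) +
    outerAct 1 (v * a) (TensorProduct.comm k R R t) ⊗ₜ u +
    outerAct 1 u (TensorProduct.comm k R R t) ⊗ₜ (a * v) -
    outerAct 1 (u * a) (TensorProduct.comm k R R t) ⊗ₜ v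

theorem mixedLeft_add (a : R) (s t : R ⊗[k] R) :
    mixedLeft u v a (s + t) = mixedLeft u v a s + mixedLeft u v a t := by
  simp only [mixedLeft, map_add, TensorProduct.add_tmul, neg_add]; abel

theorem mixedRight_add (a : R) (s t : R ⊗[k] R) :
    mixedRight u v a (s + t) = mixedRight u v a s + mixedRight u v a t := by
  simp only [mixedRight, map_add, TensorProduct.add_tmul, neg_add]; abel

/-! ### Cancellation of the mixed terms. -/

section Mixed

variable {B : Subalgebra k R} {δ₁ δ₂ : R →ₗ[k] R ⊗[k] R} {br : R →ₗ[k] R →ₗ[k] R ⊗[k] R}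
  {Q : Submodule k R}

/-- No second bracket occurs here: for `t = x ⊗ y` the eight terms of `P(a,x) ⊗ y` are matched with
`mixedLeft` when `x` lies in the second leg and with `mixedRight` when it lies in the first. The
tensor `t` is taken in `Q ⊗ Q` because the formulas for `δ₁` and `δ₂` are known on `Q` only. -/
theorem IsMatUnits.rTensor_bivectorBracket (hm : IsMatUnits e u v)
    (h₁ : ∀ x ∈ Q, δ₁ x = (x * e) ⊗ₜ e - e ⊗ₜ (e * x))
    (h₂ : ∀ x ∈ Q, δ₂ x = (x * v) ⊗ₜ u - v ⊗ₜ (u * x)) {a : R} (ha : a ∈ Q) (t : Q ⊗[k] Q) :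
    (bivectorBracket δ₁ δ₂ a).rTensor R (TensorProduct.map Q.subtype Q.subtype t) +
      cyc (mixedLeft u v a (TensorProduct.map Q.subtype Q.subtype t)) +
      cyc (cyc (mixedRight u v a (TensorProduct.map Q.subtype Q.subtype t))) = 0 := by
  induction t with
  | zero => simp [mixedLeft, mixedRight]
  | add s t hs ht =>
    simp only [map_add, mixedLeft_add, mixedRight_add]
    -- Both induction hypotheses equate a sum to `0`; the right side is split as `0 + 0` so that
    -- each zero can be replaced by one of these sums.
    rw [← add_zero (0 : (R ⊗[k] R) ⊗[k] R)]
    nth_rewrite 1 [← hs]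
    rw [← ht]
    abel
  | tmul x y =>
    simp only [TensorProduct.map_tmul, Submodule.subtype_apply, LinearMap.rTensor_tmul,
      hm.bivectorBracket_apply (h₁ a ha) (h₁ x x.2) (h₂ a ha) (h₂ x x.2), mixedLeft, mixedRight,
      TensorProduct.comm_tmul, outerAct_tmul, TensorProduct.add_tmul, TensorProduct.sub_tmul,
      map_add, map_sub, map_neg, cyc_tmul, one_mul, mul_one, mul_assoc]
    abel

/-- Since `br x` kills `u` and `v`, only `br x y` and `br x z` occur. The second is rewritten
through `br z x`, so that the cyclic sum involves just the brackets of `(a,b)`, `(b,c)` and `(c,a)`.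
-/
theorem IsMatUnits.rTensor_apply_bivectorBracket (hm : IsMatUnits e u v)
    (hbr : IsDoubleBracket B br) (hu : u ∈ B) (hv : v ∈ B)
    (h₁ : ∀ x ∈ Q, δ₁ x = (x * e) ⊗ₜ e - e ⊗ₜ (e * x))
    (h₂ : ∀ x ∈ Q, δ₂ x = (x * v) ⊗ₜ u - v ⊗ₜ (u * x)) (x : R) {y z : R}
    (hy : y ∈ Q) (hz : z ∈ Q) :
    (br x).rTensor R (bivectorBracket δ₁ δ₂ y z) =
      mixedLeft u v z (br x y) + mixedRight u v y (br z x) := by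
  have hzx : TensorProduct.comm k R R (br z x) = -br x z := by rw [hbr.antisymm x z, neg_neg]
  have hl (p q : R) (t : R ⊗[k] R) : outerAct p 1 (outerAct q 1 t) = outerAct (p * q) 1 t := by
    rw [← outerAct_mul, mul_one]
  rw [hm.bivectorBracket_apply (h₁ y hy) (h₁ z hz) (h₂ y hy) (h₂ z hz)]
  simp only [map_add, map_sub, LinearMap.rTensor_tmul, hbr.leibniz, hbr.base_right x u hu,
    hbr.base_right x v hv, map_zero, add_zero, zero_add, TensorProduct.zero_tmul, sub_zero,
    mixedLeft, mixedRight, hzx, map_neg, TensorProduct.neg_tmul, TensorProduct.add_tmul, hl]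
  abel

/-- The mixed terms in the triple bracket of `br + P` cancel. -/
theorem IsMatUnits.tripleBracket_add_bivectorBracket (hm : IsMatUnits e u v)
    (hbr : IsDoubleBracket B br) (hu : u ∈ B) (hv : v ∈ B)
    (h₁ : ∀ x ∈ Q, δ₁ x = (x * e) ⊗ₜ e - e ⊗ₜ (e * x))
    (h₂ : ∀ x ∈ Q, δ₂ x = (x * v) ⊗ₜ u - v ⊗ₜ (u * x))
    (hQ : ∀ x ∈ Q, ∀ y ∈ Q, br x y ∈ LinearMap.range (TensorProduct.map Q.subtype Q.subtype))
    (r : k) {a b c : R} (ha : a ∈ Q) (hb : b ∈ Q) (hc : c ∈ Q) :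
    tripleBracket (br + r • bivectorBracket δ₁ δ₂) a b c =
      tripleBracket br a b c + (r * r) • tripleBracket (bivectorBracket δ₁ δ₂) a b c := by
  have key {x y z : R} (hx : x ∈ Q) (hy : y ∈ Q) (hz : z ∈ Q) :
      (bivectorBracket δ₁ δ₂ x).rTensor R (br y z) =
        -cyc (mixedLeft u v x (br y z)) - cyc (cyc (mixedRight u v x (br y z))) := by
    obtain ⟨t, ht⟩ := hQ y hy z hz
    have := hm.rTensor_bivectorBracket h₁ h₂ hx t
    rw [ht] at this
    rw [← sub_eq_zero, ← this]
    abel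
  have hL {y z : R} (x : R) (hy : y ∈ Q) (hz : z ∈ Q) :=
    hm.rTensor_apply_bivectorBracket hbr hu hv h₁ h₂ x hy hz
  -- For each of `br a b`, `br b c`, `br c a`, its two `mixedLeft` terms cancel, and so do its two
  -- `mixedRight` terms; `cyc³ = 1` aligns the rotations.
  simp only [tripleBracket, LinearMap.add_apply, LinearMap.smul_apply, map_add, map_smul,
    LinearMap.rTensor_add, LinearMap.rTensor_smul, smul_add, smul_smul, key ha hb hc, key hb hc ha,
    key hc ha hb, hL a hb hc, hL b hc ha, hL c ha hb, map_sub, map_neg, smul_sub, smul_neg,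
    cyc_cyc_cyc]
  abel

end Mixed

end MatrixUnits

/-! ### Cyclic triple derivations. -/

section TripleDerivations

variable {k : Type*} [Field k] {R : Type*} [Ring R] [Algebra k R]

/-- Cyclically invariant maps `R × R × R → R ⊗ R ⊗ R` that are additive derivations in the last
argument, vanishing on `B`. -/
structure IsTripleDerivation (B : Subalgebra k R) (f : R → R → R → (R ⊗[k] R) ⊗[k] R) : Prop where
  add_right : ∀ a b c d, f a b (c + d) = f a b c + f a b d
  leibniz : ∀ a b c d, f a b (c * d) = outer₃ (1 ⊗ₜ d) (f a b c) + outer₃ (c ⊗ₜ 1) (f a b d)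
  cyc_eq : ∀ a b c, f a b c = cyc (f b c a)
  base : ∀ a b, ∀ c ∈ B, f a b c = 0

variable {B : Subalgebra k R}

theorem IsTripleDerivation.sub {f g : R → R → R → (R ⊗[k] R) ⊗[k] R}
    (hf : IsTripleDerivation B f) (hg : IsTripleDerivation B g) :
    IsTripleDerivation B (fun a b c ↦ f a b c - g a b c) where
  add_right a b c d := by simp only [hf.add_right, hg.add_right]; abel
  leibniz a b c d := by simp only [hf.leibniz, hg.leibniz, map_sub]; abel
  cyc_eq a b c := by simp only [map_sub, ← hf.cyc_eq, ← hg.cyc_eq]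
  base a b c hc := by simp [hf.base a b c hc, hg.base a b c hc]

theorem IsTripleDerivation.smul {f : R → R → R → (R ⊗[k] R) ⊗[k] R}
    (hf : IsTripleDerivation B f) (r : k) : IsTripleDerivation B (fun a b c ↦ r • f a b c) where
  add_right a b c d := by simp only [hf.add_right, smul_add]
  leibniz a b c d := by simp only [hf.leibniz, map_smul, smul_add]
  cyc_eq a b c := by simp only [map_smul, ← hf.cyc_eq]
  base a b c hc := by simp [hf.base a b c hc]

theorem IsTripleDerivation.sum {ι : Type*} [Fintype ι]
    {f : ι → R → R → R → (R ⊗[k] R) ⊗[k] R} (hf : ∀ i, IsTripleDerivation B (f i)) :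
    IsTripleDerivation B (fun a b c ↦ ∑ i, f i a b c) where
  add_right a b c d := by simp only [(hf _).add_right, Finset.sum_add_distrib]
  leibniz a b c d := by simp only [(hf _).leibniz, map_sum, Finset.sum_add_distrib]
  cyc_eq a b c := by simp only [map_sum, ← (hf _).cyc_eq]
  base a b c hc := by simp [(hf _).base a b c hc]

theorem IsDoubleBracket.isTripleDerivation {br : R →ₗ[k] R →ₗ[k] R ⊗[k] R}
    (h : IsDoubleBracket B br) : IsTripleDerivation B (tripleBracket br) where
  add_right := tripleBracket_add_right br
  leibniz := h.tripleBracket_leibniz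
  cyc_eq := tripleBracket_cyc br
  base a b _ hc := h.tripleBracket_base a b hc

theorem isTripleDerivation_trivectorBracket {δ : R →ₗ[k] R ⊗[k] R}
    (h : IsDoubleDerivation B δ) : IsTripleDerivation B (trivectorBracket δ δ δ) where
  add_right := trivectorBracket_add_right δ δ δ
  leibniz := trivectorBracket_leibniz h h h
  cyc_eq := trivectorBracket_cyc δ δ δ
  base a b _ hc := trivectorBracket_base h h h a b hc

/-- `q δ p` for the inner bimodule structure on double derivations. -/
theorem IsDoubleDerivation.innerAct_comp {δ : R →ₗ[k] R ⊗[k] R} (h : IsDoubleDerivation B δ)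
    (q p : R) : IsDoubleDerivation B (innerAct q p ∘ₗ δ) where
  leibniz a b := by
    simp only [LinearMap.comp_apply, h.leibniz, map_add, outerAct_innerAct]
  map_base b hb := by simp [h.map_base b hb]

theorem IsDoubleDerivation.add {δ δ' : R →ₗ[k] R ⊗[k] R} (h : IsDoubleDerivation B δ)
    (h' : IsDoubleDerivation B δ') : IsDoubleDerivation B (δ + δ') where
  leibniz a b := by
    simp only [LinearMap.add_apply, h.leibniz, h'.leibniz, map_add]; abel
  map_base b hb := by simp [h.map_base b hb, h'.map_base b hb]

/-- A double bracket that vanishes on `S` is linear over the algebra generated by `S`. -/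
theorem isDoubleBracket_adjoin {S : Set R} {br : R →ₗ[k] R →ₗ[k] R ⊗[k] R}
    (antisymm : ∀ a b : R, br a b = -TensorProduct.comm k R R (br b a))
    (leibniz : ∀ a b c : R, br a (b * c) = outerAct 1 c (br a b) + outerAct b 1 (br a c))
    (base : ∀ a, ∀ s ∈ S, br a s = 0) : IsDoubleBracket (Algebra.adjoin k S) br := by
  have right (a b : R) (hb : b ∈ Algebra.adjoin k S) : br a b = 0 := by
    induction hb using Algebra.adjoin_induction with
    | mem x hx => exact base a x hx
    | algebraMap r =>
      -- Gives `br a 1 = br a 1 + br a 1`, hence `br a 1 = 0` and the vanishing on scalars.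
      have := leibniz a 1 1
      rw [mul_one, outerAct_one_one, left_eq_add] at this
      rw [Algebra.algebraMap_eq_smul_one, map_smul, this, smul_zero]
    | add x y _ _ hx hy => rw [map_add, hx, hy, add_zero]
    | mul x y _ _ hx hy => simp [leibniz, hx, hy]
  exact ⟨antisymm, leibniz, right, fun b hb a ↦ by rw [antisymm, right a b hb]; simp⟩

end TripleDerivations

/-! ### Uniqueness on amalgamated products. -/

namespace Amalg

variable {k : Type*} [Field k] {C A A' : Type*} [Ring C] [Ring A] [Ring A']
  [Algebra k C] [Algebra k A] [Algebra k A'] {j : C →ₐ[k] A} {j' : C →ₐ[k] A'}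

/-- The derivation property handles the last argument. Cyclicity then brings the other two arguments
to the last position, one at a time. -/
theorem isTripleDerivation_eq_zero
    {f : Amalg j j' → Amalg j j' → Amalg j j' → (Amalg j j' ⊗[k] Amalg j j') ⊗[k] Amalg j j'}
    (hf : IsTripleDerivation (inr j j').range f)
    (h : ∀ a b c, f (inl j j' a) (inl j j' b) (inl j j' c) = 0) (x y z : Amalg j j') :
    f x y z = 0 := by
  have step (x y : Amalg j j') (h : ∀ c, f x y (inl j j' c) = 0) (z : Amalg j j') :
      f x y z = 0 := by
    induction z using Amalg.induction with
    | hl a => exact h a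
    | hr a => exact hf.base _ _ _ ⟨a, rfl⟩
    | hadd z w hz hw => rw [hf.add_right, hz, hw, add_zero]
    | hmul z w hz hw => simp [hf.leibniz, hz, hw]
  have h1 (a b z) : f (inl j j' a) (inl j j' b) z = 0 := step _ _ (h a b) z
  have h2 (z a y) : f z (inl j j' a) y = 0 :=
    step _ _ (fun b ↦ by rw [hf.cyc_eq, h1, map_zero]) y
  exact step _ _ (fun a ↦ by rw [hf.cyc_eq, h2, map_zero]) z

theorem isDoubleDerivation_ext {δ δ' : Amalg j j' →ₗ[k] Amalg j j' ⊗[k] Amalg j j'}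
    (h : IsDoubleDerivation (inr j j').range δ) (h' : IsDoubleDerivation (inr j j').range δ')
    (hl : ∀ a, δ (inl j j' a) = δ' (inl j j' a)) : δ = δ' := by
  refine LinearMap.ext fun x ↦ ?_
  induction x using Amalg.induction with
  | hl a => exact hl a
  | hr a => exact (h.map_base _ ⟨a, rfl⟩).trans (h'.map_base _ ⟨a, rfl⟩).symm
  | hadd x y hx hy => rw [map_add, map_add, hx, hy]
  | hmul x y hx hy => rw [h.leibniz, h'.leibniz, hx, hy]

theorem isDoubleDerivation_extDer {δ : A →ₗ[k] A ⊗[k] A} (hδ : IsDoubleDerivation j.range δ) :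
    IsDoubleDerivation (inr j j').range (extDer j j' δ hδ) :=
  (existsUnique_extDer hδ).choose_spec.1.1

theorem extDer_inl {δ : A →ₗ[k] A ⊗[k] A} (hδ : IsDoubleDerivation j.range δ) (a : A) :
    extDer j j' δ hδ (inl j j' a) =
      TensorProduct.map (inl j j').toLinearMap (inl j j').toLinearMap (δ a) :=
  (existsUnique_extDer hδ).choose_spec.1.2 a

theorem isDoubleBracket_extBracket {br : A →ₗ[k] A →ₗ[k] A ⊗[k] A}
    (hbr : IsDoubleBracket j.range br) :
    IsDoubleBracket (inr j j').range (extBracket j j' br hbr) :=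
  (existsUnique_extBracket hbr).choose_spec.1.1

theorem extBracket_inl {br : A →ₗ[k] A →ₗ[k] A ⊗[k] A} (hbr : IsDoubleBracket j.range br)
    (a b : A) : extBracket j j' br hbr (inl j j' a) (inl j j' b) =
      TensorProduct.map (inl j j').toLinearMap (inl j j').toLinearMap (br a b) :=
  (existsUnique_extBracket hbr).choose_spec.1.2 a b

/-- The extended bracket vanishes on the elements of `A` on which `br` vanishes. -/
theorem extBracket_inl_eq_zero {br : A →ₗ[k] A →ₗ[k] A ⊗[k] A}
    (hbr : IsDoubleBracket j.range br) {b : A} (hb : ∀ a, br b a = 0) (x : Amalg j j') :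
    extBracket j j' br hbr x (inl j j' b) = 0 := by
  have hext := isDoubleBracket_extBracket (j' := j') hbr
  suffices extBracket j j' br hbr (inl j j' b) x = 0 by rw [hext.antisymm, this]; simp
  induction x using Amalg.induction with
  | hl a => rw [extBracket_inl, hb, map_zero]
  | hr a => exact hext.base_right _ _ ⟨a, rfl⟩
  | hadd x y hx hy => rw [map_add, hx, hy, add_zero]
  | hmul x y hx hy => simp [hext.leibniz, hx, hy]

end Amalg

/-! ### The extension algebra, its Casimir element and the corrected bracket. -/

section ExtensionAlgebra

variable {k : Type*} [Field k] {A : Type*} [Ring A] [Algebra k A] {e₁ e₂ : A}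
  (h : IsOrthogonalPair e₁ e₂)

theorem matUnit_mul_same (s t r : Fin 2) :
    matUnit k h s t * matUnit k h t r = matUnit k h s r := by
  simp [matUnit, ← map_mul]

theorem matUnit_mul_of_ne {s t p r : Fin 2} (htp : t ≠ p) :
    matUnit k h s t * matUnit k h p r = 0 := by
  simp [matUnit, ← map_mul, htp, Prod.mk_zero_zero]

theorem toExt_left : toExt k h e₁ = matUnit k h 0 0 := by
  have := Amalg.inl_base (baseToAlg k h) (baseToMat k) (1, 0, 0)
  have h1 : baseToAlg k h (1, 0, 0) = e₁ := by simp [baseToAlg]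
  have h2 : baseToMat k (1, 0, 0) = (Matrix.single 0 0 1, 0) := by
    ext p q
    · fin_cases p <;> fin_cases q <;> simp [baseToMat]
    · simp [baseToMat]
  rwa [h1, h2] at this

theorem toExt_right : toExt k h e₂ = matUnit k h 1 1 := by
  have := Amalg.inl_base (baseToAlg k h) (baseToMat k) (0, 1, 0)
  have h1 : baseToAlg k h (0, 1, 0) = e₂ := by simp [baseToAlg]
  have h2 : baseToMat k (0, 1, 0) = (Matrix.single 1 1 1, 0) := by
    ext p q
    · fin_cases p <;> fin_cases q <;> simp [baseToMat]
    · simp [baseToMat]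
  rwa [h1, h2] at this

theorem isMatUnits_matUnit :
    IsMatUnits (matUnit k h 0 0) (matUnit k h 0 1) (matUnit k h 1 0) where
  uv := matUnit_mul_same h 0 1 0
  uu := matUnit_mul_of_ne h (by decide)
  vv := matUnit_mul_of_ne h (by decide)
  eu := matUnit_mul_same h 0 0 1
  ve := matUnit_mul_same h 1 0 0
  ee := matUnit_mul_same h 0 0 0

/-- A linear map vanishing on `1` and on the matrix units vanishes on `Mat₂(k) ⊕ k μ`. -/
theorem apply_inr_eq_zero {M : Type*} [AddCommGroup M] [Module k M] (D : ExtAlg k h →ₗ[k] M)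
    (h1 : D 1 = 0) (hD : ∀ s t, D (matUnit k h s t) = 0) (m : Matrix (Fin 2) (Fin 2) k × k) :
    D (Amalg.inr (baseToAlg k h) (baseToMat k) m) = 0 := by
  -- The `μ`-component is carried by the unit, which also has both diagonal matrix units in it;
  -- hence the subtraction of `m.2` from the diagonal entries.
  have hm : m = m.2 • (1 : Matrix (Fin 2) (Fin 2) k × k) +
      ((m.1 0 0 - m.2) • (Matrix.single 0 0 1, 0) + m.1 0 1 • (Matrix.single 0 1 1, 0) +
        m.1 1 0 • (Matrix.single 1 0 1, 0) + (m.1 1 1 - m.2) • (Matrix.single 1 1 1, 0)) := by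
    ext p q
    · fin_cases p <;> fin_cases q <;> simp
    · simp
  simp only [matUnit] at hD
  rw [hm]
  simp only [map_add, map_smul, map_one, h1, hD, smul_zero, add_zero]

theorem isDoubleDerivation_innerDer {Δ : ExtAlg k h ⊗[k] ExtAlg k h}
    (hΔ : ∀ s t, outerAct (matUnit k h s t) 1 Δ = outerAct 1 (matUnit k h s t) Δ) :
    IsDoubleDerivation (Amalg.inr (baseToAlg k h) (baseToMat k)).range
      (innerDer k (ExtAlg k h) Δ) where
  leibniz := innerDer_leibniz Δ
  map_base := by
    rintro _ ⟨m, rfl⟩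
    exact apply_inr_eq_zero h _ (by simp [innerDer_apply])
      (fun s t ↦ by rw [innerDer_apply, hΔ, sub_self]) m

/-- The matrix Casimir element `∑ e_{p1} ⊗ e_{1p}`. -/
def casimir : ExtAlg k h ⊗[k] ExtAlg k h :=
  matUnit k h 0 0 ⊗ₜ matUnit k h 0 0 + matUnit k h 1 0 ⊗ₜ matUnit k h 0 1

/-- Both sides equal `e_{s1} ⊗ e_{1t}`. -/
theorem outerAct_casimir (s t : Fin 2) :
    outerAct (matUnit k h s t) 1 (casimir h) = outerAct 1 (matUnit k h s t) (casimir h) := by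
  have h01 : ∀ s r, matUnit k h s 0 * matUnit k h 1 r = 0 := fun s r ↦
    matUnit_mul_of_ne h (by decide)
  have h10 : ∀ s r, matUnit k h s 1 * matUnit k h 0 r = 0 := fun s r ↦
    matUnit_mul_of_ne h (by decide)
  fin_cases s <;> fin_cases t <;>
    simp [casimir, outerAct_tmul, matUnit_mul_same, h01, h10]

/-- The gauge element is inner, given by `e ⊗ e`, and `e` annihilates every matrix unit on both
sides. -/
theorem isDoubleDerivation_gaugeElt_toExt {e : A} (h₁ : e * e₁ = 0) (h₁' : e₁ * e = 0)
    (h₂ : e * e₂ = 0) (h₂' : e₂ * e = 0) :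
    IsDoubleDerivation (Amalg.inr (baseToAlg k h) (baseToMat k)).range
      (gaugeElt k (toExt k h e)) := by
  have hl (s : Fin 2) : toExt k h e * matUnit k h s s = 0 := by
    fin_cases s
    · simp [← toExt_left, ← map_mul, h₁]
    · simp [← toExt_right, ← map_mul, h₂]
  have hr (s : Fin 2) : matUnit k h s s * toExt k h e = 0 := by
    fin_cases s
    · simp [← toExt_left, ← map_mul, h₁']
    · simp [← toExt_right, ← map_mul, h₂']
  rw [← innerDer_tmul_self]
  refine isDoubleDerivation_innerDer h fun s t ↦ ?_
  rw [outerAct_tmul, outerAct_tmul, ← matUnit_mul_same h s t t, mul_assoc, hr,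
    matUnit_mul_same, ← matUnit_mul_same h s s t, ← mul_assoc, hl]
  simp

variable (k) in
/-- The extension of the gauge element of `e₁` to the extension algebra. -/
def extGauge₁ : ExtAlg k h →ₗ[k] ExtAlg k h ⊗[k] ExtAlg k h :=
  Amalg.extDer (baseToAlg k h) (baseToMat k) (gaugeElt k e₁) (isDoubleDerivation_gaugeElt₁ k h)

variable (k) in
/-- The extension of the gauge element of `e₂` to the extension algebra. -/
def extGauge₂ : ExtAlg k h →ₗ[k] ExtAlg k h ⊗[k] ExtAlg k h :=
  Amalg.extDer (baseToAlg k h) (baseToMat k) (gaugeElt k e₂) (isDoubleDerivation_gaugeElt₂ k h)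

variable (k) in
/-- The double derivation `e₁₂ E₂ e₂₁` of the extension algebra. -/
def movedGauge₂ : ExtAlg k h →ₗ[k] ExtAlg k h ⊗[k] ExtAlg k h :=
  innerAct (matUnit k h 0 1) (matUnit k h 1 0) ∘ₗ extGauge₂ k h

theorem isDoubleDerivation_extGauge₁ :
    IsDoubleDerivation (Amalg.inr (baseToAlg k h) (baseToMat k)).range (extGauge₁ k h) :=
  Amalg.isDoubleDerivation_extDer _

theorem isDoubleDerivation_extGauge₂ :
    IsDoubleDerivation (Amalg.inr (baseToAlg k h) (baseToMat k)).range (extGauge₂ k h) :=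
  Amalg.isDoubleDerivation_extDer _

theorem isDoubleDerivation_movedGauge₂ :
    IsDoubleDerivation (Amalg.inr (baseToAlg k h) (baseToMat k)).range (movedGauge₂ k h) :=
  (isDoubleDerivation_extGauge₂ h).innerAct_comp _ _

theorem gaugeElt_apply (e x : A) : gaugeElt k e x = (x * e) ⊗ₜ e - e ⊗ₜ (e * x) := rfl

theorem extGauge₁_toExt (a : A) :
    extGauge₁ k h (toExt k h a) = (toExt k h a * matUnit k h 0 0) ⊗ₜ matUnit k h 0 0 -
      matUnit k h 0 0 ⊗ₜ (matUnit k h 0 0 * toExt k h a) := by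
  refine (Amalg.extDer_inl _ a).trans ?_
  rw [← toExt_left]
  exact map_gaugeElt (toExt k h).toLinearMap (map_mul (toExt k h)) e₁ a

theorem extGauge₂_toExt (a : A) :
    extGauge₂ k h (toExt k h a) = (toExt k h a * matUnit k h 1 1) ⊗ₜ matUnit k h 1 1 -
      matUnit k h 1 1 ⊗ₜ (matUnit k h 1 1 * toExt k h a) := by
  refine (Amalg.extDer_inl _ a).trans ?_
  rw [← toExt_right]
  exact map_gaugeElt (toExt k h).toLinearMap (map_mul (toExt k h)) e₂ a

theorem movedGauge₂_toExt (a : A) :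
    movedGauge₂ k h (toExt k h a) = (toExt k h a * matUnit k h 1 0) ⊗ₜ matUnit k h 0 1 -
      matUnit k h 1 0 ⊗ₜ (matUnit k h 0 1 * toExt k h a) := by
  rw [movedGauge₂, LinearMap.comp_apply, extGauge₂_toExt, map_sub, innerAct_tmul, innerAct_tmul,
    mul_assoc, matUnit_mul_same, matUnit_mul_same, ← mul_assoc, matUnit_mul_same]

/-- The sum of `E₁` and `e₁₂ E₂ e₂₁` is inner. -/
theorem extGauge₁_add_movedGauge₂ :
    extGauge₁ k h + movedGauge₂ k h = innerDer k (ExtAlg k h) (casimir h) := by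
  refine Amalg.isDoubleDerivation_ext
    ((isDoubleDerivation_extGauge₁ h).add (isDoubleDerivation_movedGauge₂ h))
    (isDoubleDerivation_innerDer h (outerAct_casimir h)) fun a ↦ ?_
  change extGauge₁ k h (toExt k h a) + movedGauge₂ k h (toExt k h a) =
    innerDer k (ExtAlg k h) (casimir h) (toExt k h a)
  rw [extGauge₁_toExt, movedGauge₂_toExt, innerDer_apply, casimir, map_add, map_add]
  simp only [outerAct_tmul, one_mul, mul_one]
  abel

/-- The extension of the gauge element of `e₁` takes values in `Ā e₁ ⊗ e₁ Ā`. -/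
theorem innerAct_extGauge₁ (x : ExtAlg k h) :
    innerAct (matUnit k h 0 0) (matUnit k h 0 0) (extGauge₁ k h x) = extGauge₁ k h x := by
  refine LinearMap.congr_fun (Amalg.isDoubleDerivation_ext
    ((isDoubleDerivation_extGauge₁ h).innerAct_comp (matUnit k h 0 0) (matUnit k h 0 0))
    (isDoubleDerivation_extGauge₁ h) fun a ↦ ?_) x
  change innerAct _ _ (extGauge₁ k h (toExt k h a)) = extGauge₁ k h (toExt k h a)
  rw [extGauge₁_toExt, map_sub, innerAct_tmul, innerAct_tmul, mul_assoc, matUnit_mul_same,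
    ← mul_assoc, matUnit_mul_same]

theorem innerAct_extGauge₂ (x : ExtAlg k h) :
    innerAct (matUnit k h 1 1) (matUnit k h 1 1) (extGauge₂ k h x) = extGauge₂ k h x := by
  refine LinearMap.congr_fun (Amalg.isDoubleDerivation_ext
    ((isDoubleDerivation_extGauge₂ h).innerAct_comp (matUnit k h 1 1) (matUnit k h 1 1))
    (isDoubleDerivation_extGauge₂ h) fun a ↦ ?_) x
  change innerAct _ _ (extGauge₂ k h (toExt k h a)) = extGauge₂ k h (toExt k h a)
  rw [extGauge₂_toExt, map_sub, innerAct_tmul, innerAct_tmul, mul_assoc, matUnit_mul_same,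
    ← mul_assoc, matUnit_mul_same]

/-- The trivector brackets of `E₂` and of `e₁₂ E₂ e₂₁` agree on `A`. -/
theorem trivectorBracket_movedGauge₂ (a b c : A) :
    trivectorBracket (movedGauge₂ k h) (movedGauge₂ k h) (movedGauge₂ k h)
      (toExt k h a) (toExt k h b) (toExt k h c) =
    trivectorBracket (gaugeElt k (toExt k h e₂)) (gaugeElt k (toExt k h e₂))
      (gaugeElt k (toExt k h e₂)) (toExt k h a) (toExt k h b) (toExt k h c) := by
  have h1 (x : ExtAlg k h) :
      matUnit k h 1 0 * (matUnit k h 0 1 * x) = matUnit k h 1 1 * x := by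
    rw [← mul_assoc, matUnit_mul_same]
  have h2 (x : ExtAlg k h) :
      matUnit k h 1 1 * (matUnit k h 1 1 * x) = matUnit k h 1 1 * x := by
    rw [← mul_assoc, matUnit_mul_same]
  simp only [trivectorBracket_eq, movedGauge₂_toExt, toExt_right, gaugeElt_apply,
    contract₃_sub_left, contract₃_sub_mid, contract₃_sub_right, contract₃_tmul, mul_assoc,
    matUnit_mul_same, h1, h2]

/-- The extension of a double bracket to the extension algebra, corrected by the bivector
`-1/2 E₁ (e₁₂ E₂ e₂₁)`. -/
def extFusBracket (br : A →ₗ[k] A →ₗ[k] A ⊗[k] A)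
    (hbr : IsDoubleBracket (baseToAlg k h).range br) :
    ExtAlg k h →ₗ[k] ExtAlg k h →ₗ[k] ExtAlg k h ⊗[k] ExtAlg k h :=
  Amalg.extBracket (baseToAlg k h) (baseToMat k) br hbr +
    (-(1 / 2) : k) • bivectorBracket (extGauge₁ k h) (movedGauge₂ k h)

theorem isDoubleBracket_extFusBracket {br : A →ₗ[k] A →ₗ[k] A ⊗[k] A}
    (hbr : IsDoubleBracket (baseToAlg k h).range br) :
    IsDoubleBracket (Amalg.inr (baseToAlg k h) (baseToMat k)).range (extFusBracket h br hbr) :=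
  (Amalg.isDoubleBracket_extBracket hbr).add ((isDoubleBracket_bivectorBracket
    (isDoubleDerivation_extGauge₁ h) (isDoubleDerivation_movedGauge₂ h)).smul _)

/-- Of the eight words in `δ₁`, `δ₂`, the six mixed ones form two cyclic classes of three, and the
trivector bracket depends only on the class. -/
theorem trivectorBracket_add_self {R : Type*} [Ring R] [Algebra k R]
    (δ₁ δ₂ : R →ₗ[k] R ⊗[k] R) (a b c : R) :
    trivectorBracket (δ₁ + δ₂) (δ₁ + δ₂) (δ₁ + δ₂) a b c =
      trivectorBracket δ₁ δ₁ δ₁ a b c + trivectorBracket δ₂ δ₂ δ₂ a b c +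
        (3 : k) • (trivectorBracket δ₁ δ₁ δ₂ a b c + trivectorBracket δ₁ δ₂ δ₂ a b c) := by
  simp only [trivectorBracket_eq, LinearMap.add_apply, contract₃_add_left, contract₃_add_mid,
    contract₃_add_right]
  module

/-- The bivector contributes `1/4 (E₁²F + E₁F²)`, which is `1/12 ((E₁+F)³ - E₁³ - F³)`, with `E₁+F`
inner. The cubes of `E₁` and `F` can be written with gauge elements because the arguments come from
`A`. -/
theorem tripleBracket_extFusBracket_toExt [CharZero k] {br : A →ₗ[k] A →ₗ[k] A ⊗[k] A}
    (hbr : IsDoubleBracket (baseToAlg k h).range br) (a b c : A) :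
    tripleBracket (extFusBracket h br hbr) (toExt k h a) (toExt k h b) (toExt k h c) =
      map₃ (toExt k h).toLinearMap (tripleBracket br a b c) + (1 / 12 : k) •
        (trivectorBracket (innerDer k (ExtAlg k h) (casimir h))
            (innerDer k (ExtAlg k h) (casimir h)) (innerDer k (ExtAlg k h) (casimir h))
            (toExt k h a) (toExt k h b) (toExt k h c) -
          trivectorBracket (gaugeElt k (toExt k h e₁)) (gaugeElt k (toExt k h e₁))
            (gaugeElt k (toExt k h e₁)) (toExt k h a) (toExt k h b) (toExt k h c) -
          trivectorBracket (gaugeElt k (toExt k h e₂)) (gaugeElt k (toExt k h e₂))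
            (gaugeElt k (toExt k h e₂)) (toExt k h a) (toExt k h b) (toExt k h c)) := by
  set Q : Submodule k (ExtAlg k h) := LinearMap.range (toExt k h).toLinearMap
  have h₁ : ∀ x ∈ Q, extGauge₁ k h x = (x * matUnit k h 0 0) ⊗ₜ matUnit k h 0 0 -
      matUnit k h 0 0 ⊗ₜ (matUnit k h 0 0 * x) := by
    rintro _ ⟨x, rfl⟩; exact extGauge₁_toExt h x
  have h₂ : ∀ x ∈ Q, movedGauge₂ k h x = (x * matUnit k h 1 0) ⊗ₜ matUnit k h 0 1 -
      matUnit k h 1 0 ⊗ₜ (matUnit k h 0 1 * x) := by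
    rintro _ ⟨x, rfl⟩; exact movedGauge₂_toExt h x
  have hQ (x : A) : toExt k h x ∈ Q := ⟨x, rfl⟩
  have hu (s t : Fin 2) : matUnit k h s t ∈ (Amalg.inr (baseToAlg k h) (baseToMat k)).range :=
    ⟨_, rfl⟩
  have hrange : ∀ x ∈ Q, ∀ y ∈ Q, Amalg.extBracket (baseToAlg k h) (baseToMat k) br hbr x y ∈
      LinearMap.range (TensorProduct.map Q.subtype Q.subtype) := by
    rintro _ ⟨x, rfl⟩ _ ⟨y, rfl⟩
    refine ⟨TensorProduct.map (toExt k h).toLinearMap.rangeRestrict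
      (toExt k h).toLinearMap.rangeRestrict (br x y), ?_⟩
    rw [← LinearMap.comp_apply, ← TensorProduct.map_comp]
    exact (Amalg.extBracket_inl hbr x y).symm
  -- This is specific to the image of `A`: `extGauge₁` kills the matrix units, whereas the gauge
  -- element of `e₁` in `Ā` need not.
  have hg₁ (x : A) : extGauge₁ k h (toExt k h x) = gaugeElt k (toExt k h e₁) (toExt k h x) := by
    rw [extGauge₁_toExt, toExt_left]; rfl
  rw [extFusBracket, (isMatUnits_matUnit h).tripleBracket_add_bivectorBracket
    (Amalg.isDoubleBracket_extBracket hbr) (hu 0 1) (hu 1 0) h₁ h₂ hrange _ (hQ a) (hQ b) (hQ c),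
    (isMatUnits_matUnit h).tripleBracket_bivectorBracket (isDoubleDerivation_extGauge₁ h)
      (isDoubleDerivation_movedGauge₂ h) (hu 0 1) (hu 1 0) h₁ h₂ (hQ a) (hQ b) (hQ c),
    ← extGauge₁_add_movedGauge₂, trivectorBracket_add_self, trivectorBracket_movedGauge₂,
    trivectorBracket_eq (gaugeElt k (toExt k h e₁)), trivectorBracket_eq (extGauge₁ k h)
      (extGauge₁ k h) (extGauge₁ k h), hg₁, hg₁, hg₁,
    map₃_tripleBracket (toExt k h).toLinearMap
      (fun x y ↦ (Amalg.extBracket_inl (j' := baseToMat k) hbr x y).symm)]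
  simp only [AlgHom.toLinearMap_apply]
  module

end ExtensionAlgebra

/-! ### Restriction to the corner `εRε`. -/

section Corner

variable {k : Type*} [Field k] {R : Type*} [Ring R] [Algebra k R] {ε : R}

theorem cornerIncl_mul (hε : IsIdempotentElem ε) (x y : hε.Corner) :
    cornerIncl k hε (x * y) = cornerIncl k hε x * cornerIncl k hε y := rfl

theorem cornerIncl_cornerProj (hε : IsIdempotentElem ε) (x : R) :
    cornerIncl k hε (cornerProj k hε x) = ε * x * ε := rfl

theorem mul_cornerIncl (hε : IsIdempotentElem ε) (x : hε.Corner) :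
    ε * cornerIncl k hε x = cornerIncl k hε x := by
  obtain ⟨_, r, rfl⟩ := x
  change ε * (ε * r * ε) = ε * r * ε
  simp only [← mul_assoc, hε.eq]

theorem cornerIncl_mul_self (hε : IsIdempotentElem ε) (x : hε.Corner) :
    cornerIncl k hε x * ε = cornerIncl k hε x := by
  obtain ⟨_, r, rfl⟩ := x
  change ε * r * ε * ε = ε * r * ε
  rw [mul_assoc, hε.eq]

theorem cornerIncl_injective (hε : IsIdempotentElem ε) :
    Function.Injective (cornerIncl k hε) := Subtype.val_injective

theorem cornerProj_cornerIncl (hε : IsIdempotentElem ε) (x : hε.Corner) :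
    cornerProj k hε (cornerIncl k hε x) = x :=
  cornerIncl_injective (k := k) hε (by
    rw [cornerIncl_cornerProj, mul_cornerIncl, cornerIncl_mul_self])

theorem cornerProj_comp_cornerIncl (hε : IsIdempotentElem ε) :
    cornerProj k hε ∘ₗ cornerIncl k hε = LinearMap.id :=
  LinearMap.ext (cornerProj_cornerIncl hε)

/-- The inclusion is split by `x ↦ εxε`, so its tensor powers are split as well. Identities in the
corner can therefore be checked in `R`. -/
theorem map_cornerIncl_injective (hε : IsIdempotentElem ε) :
    Function.Injective (TensorProduct.map (cornerIncl k hε) (cornerIncl k hε)) := by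
  refine Function.LeftInverse.injective
    (g := TensorProduct.map (cornerProj k hε) (cornerProj k hε)) fun t ↦ ?_
  rw [← LinearMap.comp_apply, ← TensorProduct.map_comp, cornerProj_comp_cornerIncl,
    TensorProduct.map_id, LinearMap.id_apply]

theorem map₃_cornerIncl_injective (hε : IsIdempotentElem ε) :
    Function.Injective (map₃ (cornerIncl k hε)) := by
  refine Function.LeftInverse.injective (g := TensorProduct.map
    (TensorProduct.map (cornerProj k hε) (cornerProj k hε)) (cornerProj k hε)) fun t ↦ ?_
  rw [map₃, ← LinearMap.comp_apply, ← TensorProduct.map_comp, ← TensorProduct.map_comp,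
    cornerProj_comp_cornerIncl, TensorProduct.map_id, TensorProduct.map_id, LinearMap.id_apply]

theorem map_cornerIncl_map_cornerProj (hε : IsIdempotentElem ε) (t : R ⊗[k] R) :
    TensorProduct.map (cornerIncl k hε) (cornerIncl k hε)
      (TensorProduct.map (cornerProj k hε) (cornerProj k hε) t) =
    innerAct ε ε (outerAct ε ε t) := by
  induction t with
  | zero => simp
  | add u v hu hv => simp only [map_add, hu, hv]
  | tmul x y =>
    simp only [TensorProduct.map_tmul, cornerIncl_cornerProj, innerAct_tmul, outerAct_tmul,
      mul_assoc]

variable {B : Subalgebra k R}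

/-- Apply `δ` to `x = εxε` and use `δ(ε) = 0`. -/
theorem IsDoubleDerivation.outerAct_corner (hε : IsIdempotentElem ε) (hB : ε ∈ B)
    {δ : R →ₗ[k] R ⊗[k] R} (hδ : IsDoubleDerivation B δ) (x : hε.Corner) :
    outerAct ε ε (δ (cornerIncl k hε x)) = δ (cornerIncl k hε x) := by
  conv_rhs => rw [← mul_cornerIncl hε x, ← cornerIncl_mul_self hε x]
  simp only [hδ.leibniz, hδ.map_base ε hB, map_zero, zero_add, add_zero, ← outerAct_mul, mul_one]

theorem map_cornerIncl_cornerDer (hε : IsIdempotentElem ε) (hB : ε ∈ B) (q p : R)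
    {δ : R →ₗ[k] R ⊗[k] R} (hδ : IsDoubleDerivation B δ) (x : hε.Corner) :
    TensorProduct.map (cornerIncl k hε) (cornerIncl k hε) (cornerDer hε q p δ x) =
      innerAct (ε * q) (p * ε) (δ (cornerIncl k hε x)) := by
  simp only [cornerDer, LinearMap.comp_apply, map_cornerIncl_map_cornerProj, outerAct_innerAct,
    hδ.outerAct_corner hε hB, innerAct_mul]

/-- Writing `x = εxε` and `y = εyε`, linearity over `ε` already puts `ε` on both sides of both legs
of the bracket, so the projection changes nothing. -/
theorem map_cornerIncl_cornerBracket (hε : IsIdempotentElem ε) (hB : ε ∈ B)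
    {br : R →ₗ[k] R →ₗ[k] R ⊗[k] R} (hbr : IsDoubleBracket B br) (x y : hε.Corner) :
    TensorProduct.map (cornerIncl k hε) (cornerIncl k hε) (cornerBracket hε br x y) =
      br (cornerIncl k hε x) (cornerIncl k hε y) := by
  change TensorProduct.map _ _ (TensorProduct.map (cornerProj k hε) (cornerProj k hε)
    (br (cornerIncl k hε x) (cornerIncl k hε y))) = _
  rw [map_cornerIncl_map_cornerProj]
  conv_rhs => rw [← mul_cornerIncl hε x, ← cornerIncl_mul_self hε x,
    ← mul_cornerIncl hε y, ← cornerIncl_mul_self hε y]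
  simp only [hbr.leibniz, hbr.leibniz_left, hbr.base_right _ ε hB, hbr.base_left ε hB, map_zero,
    zero_add, add_zero, outerAct_innerAct, ← outerAct_mul, ← innerAct_mul, mul_one]

end Corner

/-! ### Double brackets pulled back along an embedding. -/

section Pullback

variable {k : Type*} [Field k] {Q R : Type*} [Ring Q] [Algebra k Q] [Ring R] [Algebra k R]
  {B : Subalgebra k R}

/-- A bracket that embeds multiplicatively into a double bracket is a double bracket. -/
theorem IsDoubleBracket.of_injective {f : Q →ₗ[k] R} (hf : ∀ x y, f (x * y) = f x * f y)
    (hinj : Function.Injective (TensorProduct.map f f)) {br : Q →ₗ[k] Q →ₗ[k] Q ⊗[k] Q}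
    {br' : R →ₗ[k] R →ₗ[k] R ⊗[k] R} (hbr' : IsDoubleBracket B br')
    (hbr : ∀ x y, TensorProduct.map f f (br x y) = br' (f x) (f y))
    {S : Set Q} (hS : ∀ x, ∀ s ∈ S, br' x (f s) = 0) :
    IsDoubleBracket (Algebra.adjoin k S) br := by
  have hl (x : Q) (t : Q ⊗[k] Q) : TensorProduct.map f f (outerAct x 1 t) =
      outerAct (f x) 1 (TensorProduct.map f f t) := by
    induction t with
    | zero => simp
    | add u v hu hv => simp only [map_add, hu, hv]
    | tmul a b => simp [outerAct_tmul, hf]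
  have hr (x : Q) (t : Q ⊗[k] Q) : TensorProduct.map f f (outerAct 1 x t) =
      outerAct 1 (f x) (TensorProduct.map f f t) := by
    induction t with
    | zero => simp
    | add u v hu hv => simp only [map_add, hu, hv]
    | tmul a b => simp [outerAct_tmul, hf]
  refine isDoubleBracket_adjoin (fun a b ↦ hinj ?_) (fun a b c ↦ hinj ?_)
    (fun a s hs ↦ hinj ?_)
  · rw [map_neg, TensorProduct.map_comm, hbr, hbr, hbr'.antisymm]
  · rw [map_add, hl, hr, hbr, hbr, hbr, hf, hbr'.leibniz]
  · rw [hbr, hS _ s hs, map_zero]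

end Pullback

/-! ### The fused bracket as a restriction from the extension algebra. -/

section Fusion

variable {k : Type*} [Field k] {A : Type*} [Ring A] [Algebra k A] {e₁ e₂ : A}
  (h : IsOrthogonalPair e₁ e₂)

variable (k) in
/-- The inclusion of the fusion algebra into the extension algebra. -/
abbrev fusIncl : FusAlg k h →ₗ[k] ExtAlg k h := cornerIncl k (isIdempotentElem_eps k h)

theorem eps_mem_range :
    1 - toExt k h e₂ ∈ (Amalg.inr (baseToAlg k h) (baseToMat k)).range := by
  rw [toExt_right]
  exact sub_mem (one_mem _) ⟨_, rfl⟩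

theorem eps_mul_matUnit_zero (t : Fin 2) :
    (1 - toExt k h e₂) * matUnit k h 0 t = matUnit k h 0 t := by
  rw [toExt_right, sub_mul, one_mul, matUnit_mul_of_ne h (by decide), sub_zero]

theorem matUnit_zero_mul_eps (s : Fin 2) :
    matUnit k h s 0 * (1 - toExt k h e₂) = matUnit k h s 0 := by
  rw [toExt_right, mul_sub, mul_one, matUnit_mul_of_ne h (by decide), sub_zero]

theorem eps_mul_matUnit_one (t : Fin 2) : (1 - toExt k h e₂) * matUnit k h 1 t = 0 := by
  rw [toExt_right, sub_mul, one_mul, matUnit_mul_same, sub_self]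

theorem matUnit_one_mul_eps (s : Fin 2) : matUnit k h s 1 * (1 - toExt k h e₂) = 0 := by
  rw [toExt_right, mul_sub, mul_one, matUnit_mul_same, sub_self]

theorem innerAct_zero_left {R : Type*} [Ring R] [Algebra k R] (p : R) (t : R ⊗[k] R) :
    innerAct 0 p t = 0 := by
  simp [innerAct]

/-- Values of `E₁` lie in `Ā e₁ ⊗ e₁ Ā`. There `ε` acts as the identity, since `ε e₁ = e₁ = e₁ ε`,
while the summand twisted by `e₂₁` and `e₁₂` vanishes because `e₁₂ e₁ = 0`. -/
theorem map_fusIncl_trDer₁ (x : FusAlg k h) :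
    TensorProduct.map (fusIncl k h) (fusIncl k h)
      (trDer h (gaugeElt k e₁) (isDoubleDerivation_gaugeElt₁ k h) x) =
      extGauge₁ k h (fusIncl k h x) := by
  have hδ := isDoubleDerivation_extGauge₁ (k := k) h
  change TensorProduct.map _ _ (cornerDer _ 1 1 (extGauge₁ k h) x +
    cornerDer _ (matUnit k h 0 1) (matUnit k h 1 0) (extGauge₁ k h) x) = _
  rw [map_add, map_cornerIncl_cornerDer _ (eps_mem_range h) _ _ hδ,
    map_cornerIncl_cornerDer _ (eps_mem_range h) _ _ hδ]
  rw [← innerAct_extGauge₁, ← innerAct_mul, ← innerAct_mul, mul_one, one_mul,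
    eps_mul_matUnit_zero, eps_mul_matUnit_zero, matUnit_zero_mul_eps, matUnit_zero_mul_eps,
    matUnit_mul_of_ne h (show (1 : Fin 2) ≠ 0 by decide), innerAct_zero_left, add_zero]

/-- The roles are exchanged: values of `E₂` lie in `Ā e₂ ⊗ e₂ Ā`, so the untwisted summand dies by
`ε e₂ = 0` and the twisted one is `e₁₂ E₂ e₂₁`. -/
theorem map_fusIncl_trDer₂ (x : FusAlg k h) :
    TensorProduct.map (fusIncl k h) (fusIncl k h)
      (trDer h (gaugeElt k e₂) (isDoubleDerivation_gaugeElt₂ k h) x) =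
      movedGauge₂ k h (fusIncl k h x) := by
  have hδ := isDoubleDerivation_extGauge₂ (k := k) h
  change TensorProduct.map _ _ (cornerDer _ 1 1 (extGauge₂ k h) x +
    cornerDer _ (matUnit k h 0 1) (matUnit k h 1 0) (extGauge₂ k h) x) = _
  rw [map_add, map_cornerIncl_cornerDer _ (eps_mem_range h) _ _ hδ,
    map_cornerIncl_cornerDer _ (eps_mem_range h) _ _ hδ]
  rw [movedGauge₂, LinearMap.comp_apply, eps_mul_matUnit_zero, matUnit_zero_mul_eps]
  nth_rewrite 1 [← innerAct_extGauge₂]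
  rw [← innerAct_mul, mul_one, eps_mul_matUnit_one, innerAct_zero_left, zero_add]

theorem map_fusIncl_bracket {br : A →ₗ[k] A →ₗ[k] A ⊗[k] A}
    (hbr : IsDoubleBracket (baseToAlg k h).range br) (x y : FusAlg k h) :
    TensorProduct.map (fusIncl k h) (fusIncl k h)
      ((inducedBracket h br hbr + fusBracket k h) x y) =
      extFusBracket h br hbr (fusIncl k h x) (fusIncl k h y) := by
  simp only [extFusBracket, fusBracket, inducedBracket, LinearMap.add_apply, map_add,
    LinearMap.smul_apply, map_smul, bivectorBracket_apply, map_sub]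
  rw [map_cornerIncl_cornerBracket _ (eps_mem_range h) (Amalg.isDoubleBracket_extBracket hbr),
    map_contract₂ _ (cornerIncl_mul _), map_contract₂ _ (cornerIncl_mul _),
    map_fusIncl_trDer₁, map_fusIncl_trDer₁, map_fusIncl_trDer₂, map_fusIncl_trDer₂]

theorem fusIncl_toFus {e : A} (h₂ : e * e₂ = 0) (h₂' : e₂ * e = 0) :
    fusIncl k h (toFus k h e) = toExt k h e := by
  change (1 - toExt k h e₂) * toExt k h e * (1 - toExt k h e₂) = _
  rw [sub_mul, one_mul, ← map_mul, h₂', map_zero, sub_zero, mul_sub, mul_one, ← map_mul, h₂,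
    map_zero, sub_zero]

/-- As `x = εxε`, one has `x e₂₁ = 0` and `e₁₂ x = 0`, so the off-diagonal term of the Casimir
element contributes nothing. -/
theorem innerDer_casimir_fusIncl (x : FusAlg k h) :
    innerDer k (ExtAlg k h) (casimir h) (fusIncl k h x) =
      gaugeElt k (toExt k h e₁) (fusIncl k h x) := by
  have h1 : fusIncl k h x * matUnit k h 1 0 = 0 := by
    rw [← cornerIncl_mul_self, mul_assoc, eps_mul_matUnit_one, mul_zero]
  have h2 : matUnit k h 0 1 * fusIncl k h x = 0 := by
    rw [← mul_cornerIncl, ← mul_assoc, matUnit_one_mul_eps, zero_mul]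
  rw [innerDer_apply, casimir, gaugeElt_apply, map_add, map_add, toExt_left]
  simp [outerAct_tmul, h1, h2]

theorem extGauge₁_toExt_eq_zero {a : A} (ha : gaugeElt k e₁ a = 0) :
    extGauge₁ k h (toExt k h a) = 0 :=
  (Amalg.extDer_inl _ a).trans (by rw [ha, map_zero])

theorem movedGauge₂_toExt_eq_zero {a : A} (ha : gaugeElt k e₂ a = 0) :
    movedGauge₂ k h (toExt k h a) = 0 := by
  have : extGauge₂ k h (toExt k h a) = 0 := (Amalg.extDer_inl _ a).trans (by rw [ha, map_zero])
  rw [movedGauge₂, LinearMap.comp_apply, this, map_zero]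

end Fusion

/-! ### The family of idempotents and the quasi-Poisson identity. -/

section FusionOfIdempotents

variable {k : Type*} [Field k] {A : Type*} [Ring A] [Algebra k A] {I : Type*} [Fintype I]
  {e : I → A}

theorem gaugeElt_apply_idempotent (he : CompleteOrthogonalIdempotents e) (s t : I) :
    gaugeElt k (e s) (e t) = 0 := by
  rcases eq_or_ne s t with rfl | hst
  · rw [gaugeElt_apply, he.idem s, sub_self]
  · rw [gaugeElt_apply, he.ortho hst, he.ortho hst.symm]; simp

theorem completeOrthogonalIdempotents_toFus (he : CompleteOrthogonalIdempotents e) {i j : I}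
    (hij : i ≠ j) [DecidableEq I] :
    CompleteOrthogonalIdempotents
      (fun s : {s : I // s ≠ j} ↦ toFus k (he.isOrthogonalPair hij) (e s)) := by
  have hincl (s : {s : I // s ≠ j}) := fusIncl_toFus (k := k) (he.isOrthogonalPair hij)
    (he.ortho s.2) (he.ortho s.2.symm)
  have hinj := cornerIncl_injective (k := k) (isIdempotentElem_eps k (he.isOrthogonalPair hij))
  refine ⟨⟨fun s ↦ hinj ?_, fun s t hst ↦ hinj ?_⟩, hinj ?_⟩
  · rw [cornerIncl_mul, hincl, ← map_mul, he.idem s]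
  · rw [cornerIncl_mul, hincl, hincl, ← map_mul, he.ortho (Subtype.coe_ne_coe.mpr hst), map_zero,
      map_zero]
  · rw [map_sum]
    simp only [hincl]
    -- The remaining idempotents add up to `1 - e_j = ε`, which is the unit of the corner.
    have := he.complete
    rw [Fintype.sum_eq_add_sum_subtype_ne e j] at this
    rw [← map_sum, eq_sub_of_add_eq' this, map_sub, map_one]
    rfl

theorem extFusBracket_toExt_idempotent {i j : I} (h : IsOrthogonalPair (e i) (e j))
    {br : A →ₗ[k] A →ₗ[k] A ⊗[k] A}
    (hqp : IsDoubleQuasiPoisson e br) (hbr : IsDoubleBracket (baseToAlg k h).range br)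
    (x : ExtAlg k h) (s : I) : extFusBracket h br hbr x (toExt k h (e s)) = 0 := by
  have hs : e s ∈ Algebra.adjoin k (Set.range e) := Algebra.subset_adjoin ⟨s, rfl⟩
  have h0 : Amalg.extBracket (baseToAlg k h) (baseToMat k) br hbr x (toExt k h (e s)) = 0 :=
    Amalg.extBracket_inl_eq_zero hbr (hqp.bracket.base_left _ hs) x
  rw [extFusBracket, LinearMap.add_apply, LinearMap.add_apply, h0, LinearMap.smul_apply,
    LinearMap.smul_apply, bivectorBracket_apply,
    extGauge₁_toExt_eq_zero h (gaugeElt_apply_idempotent hqp.idem i s),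
    movedGauge₂_toExt_eq_zero h (gaugeElt_apply_idempotent hqp.idem j s)]
  simp

variable [DecidableEq I] {i j : I} (h : IsOrthogonalPair (e i) (e j))

variable (k) in
/-- The double derivations of the extension algebra that restrict to the gauge elements of the
fusion algebra. -/
def extFusGauge (s : I) : ExtAlg k h →ₗ[k] ExtAlg k h ⊗[k] ExtAlg k h :=
  if s = i then innerDer k (ExtAlg k h) (casimir h) else gaugeElt k (toExt k h (e s))

theorem isDoubleDerivation_extFusGauge (he : CompleteOrthogonalIdempotents e) {s : I}
    (hs : s ≠ j) :
    IsDoubleDerivation (Amalg.inr (baseToAlg k h) (baseToMat k)).range (extFusGauge k h s) := by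
  unfold extFusGauge
  split_ifs with hsi
  · exact isDoubleDerivation_innerDer _ (outerAct_casimir _)
  · exact isDoubleDerivation_gaugeElt_toExt _ (he.ortho hsi) (he.ortho (Ne.symm hsi))
      (he.ortho hs) (he.ortho hs.symm)

/-- Matches the correction term of `tripleBracket_extFusBracket_toExt`: the cube at `j` is dropped
and the one at `i` is replaced by that of the inner derivation. -/
theorem sum_trivectorBracket_extFusGauge (hij : i ≠ j) (x y z : ExtAlg k h) :
    ∑ s : {s : I // s ≠ j}, trivectorBracket (extFusGauge k h s) (extFusGauge k h s)
        (extFusGauge k h s) x y z =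
      ∑ s, trivectorBracket (gaugeElt k (toExt k h (e s))) (gaugeElt k (toExt k h (e s)))
        (gaugeElt k (toExt k h (e s))) x y z +
      (trivectorBracket (innerDer k (ExtAlg k h) (casimir h))
          (innerDer k (ExtAlg k h) (casimir h)) (innerDer k (ExtAlg k h) (casimir h)) x y z -
        trivectorBracket (gaugeElt k (toExt k h (e i))) (gaugeElt k (toExt k h (e i)))
          (gaugeElt k (toExt k h (e i))) x y z -
        trivectorBracket (gaugeElt k (toExt k h (e j))) (gaugeElt k (toExt k h (e j)))
          (gaugeElt k (toExt k h (e j))) x y z) := by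
  generalize hg : (fun s ↦ trivectorBracket (gaugeElt k (toExt k h (e s)))
    (gaugeElt k (toExt k h (e s))) (gaugeElt k (toExt k h (e s))) x y z) = g
  have hg' (s : I) : trivectorBracket (gaugeElt k (toExt k h (e s)))
    (gaugeElt k (toExt k h (e s))) (gaugeElt k (toExt k h (e s))) x y z = g s := congrFun hg s
  generalize hw : trivectorBracket (innerDer k (ExtAlg k h) (casimir h))
    (innerDer k (ExtAlg k h) (casimir h)) (innerDer k (ExtAlg k h) (casimir h)) x y z = w
  have hsum (s : {s : I // s ≠ j}) : trivectorBracket (extFusGauge k h s) (extFusGauge k h s)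
      (extFusGauge k h s) x y z = g s + if s = ⟨i, hij⟩ then w - g i else 0 := by
    by_cases hs : s = ⟨i, hij⟩
    · subst hs
      rw [extFusGauge, if_pos rfl, if_pos rfl, hw, add_sub_cancel]
    · have hsi : (s : I) ≠ i := fun h ↦ hs (Subtype.ext h)
      rw [extFusGauge, if_neg hsi, if_neg hs, hg', add_zero]
  simp only [hsum, hg', Finset.sum_add_distrib, Finset.sum_ite_eq', Finset.mem_univ, if_true]
  rw [Fintype.sum_eq_add_sum_subtype_ne g j]
  abel

/-- The quasi-Poisson property of the corrected bracket on the extension algebra. -/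
theorem tripleBracket_extFusBracket [CharZero k] {br : A →ₗ[k] A →ₗ[k] A ⊗[k] A}
    (hqp : IsDoubleQuasiPoisson e br) (hij : i ≠ j)
    (hbr : IsDoubleBracket (baseToAlg k h).range br) (x y z : ExtAlg k h) :
    tripleBracket (extFusBracket h br hbr) x y z =
      (1 / 12 : k) • ∑ s : {s : I // s ≠ j}, trivectorBracket (extFusGauge k h s)
        (extFusGauge k h s) (extFusGauge k h s) x y z := by
  have hL := (isDoubleBracket_extFusBracket h hbr).isTripleDerivation
  have hR := (IsTripleDerivation.sum fun s : {s : I // s ≠ j} ↦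
    isTripleDerivation_trivectorBracket
      (isDoubleDerivation_extFusGauge (k := k) h hqp.idem s.2)).smul (1 / 12 : k)
  refine sub_eq_zero.mp (Amalg.isTripleDerivation_eq_zero (hL.sub hR) (fun a b c ↦ ?_) x y z)
  -- On `A` the quasi-Poisson hypothesis turns the triple bracket of `br` into `1/12 ∑ E_s³`, pushed
  -- forward to `Ā`.
  refine sub_eq_zero.mpr ((tripleBracket_extFusBracket_toExt h hbr a b c).trans ?_)
  have hmap (s : I) := map₃_trivectorBracket (toExt k h).toLinearMap (map_mul (toExt k h))
    (map_gaugeElt (toExt k h).toLinearMap (map_mul (toExt k h)) (e s)) a b c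
  rw [hqp.quasiPoisson, map_smul, map_sum, ← smul_add]
  refine congrArg _ (Eq.trans ?_ (sum_trivectorBracket_extFusGauge h hij _ _ _).symm)
  rw [Finset.sum_congr rfl fun s _ ↦ hmap s]
  rfl

theorem map_fusIncl_gaugeElt (he : CompleteOrthogonalIdempotents e) {s : I} (hs : s ≠ j)
    (x : FusAlg k h) :
    TensorProduct.map (fusIncl k h) (fusIncl k h) (gaugeElt k (toFus k h (e s)) x) =
      extFusGauge k h s (fusIncl k h x) := by
  rw [map_gaugeElt _ (cornerIncl_mul _), fusIncl_toFus h (he.ortho hs) (he.ortho hs.symm),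
    extFusGauge]
  split_ifs with hsi
  · subst hsi; exact (innerDer_casimir_fusIncl h x).symm
  · rfl

/-- The bracket axioms and the quasi-Poisson identity are pulled back from `Ā`, since the inclusion
of the corner stays injective on second and third tensor powers. -/
theorem isDoubleQuasiPoisson_fusion [CharZero k] {br : A →ₗ[k] A →ₗ[k] A ⊗[k] A}
    (hqp : IsDoubleQuasiPoisson e br) (hij : i ≠ j)
    (hbr : IsDoubleBracket (baseToAlg k h).range br) :
    IsDoubleQuasiPoisson (fun s : {s : I // s ≠ j} ↦ toFus k h (e s))
      (inducedBracket h br hbr + fusBracket k h) where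
  idem := completeOrthogonalIdempotents_toFus hqp.idem hij
  bracket := by
    refine IsDoubleBracket.of_injective (f := fusIncl k h) (cornerIncl_mul _)
      (map_cornerIncl_injective _) (isDoubleBracket_extFusBracket h hbr)
      (map_fusIncl_bracket h hbr) ?_
    rintro x _ ⟨s, rfl⟩
    rw [fusIncl_toFus h (hqp.idem.ortho s.2) (hqp.idem.ortho s.2.symm)]
    exact extFusBracket_toExt_idempotent h hqp hbr x s
  quasiPoisson a b c := by
    refine map₃_cornerIncl_injective (isIdempotentElem_eps k h) ?_
    rw [map₃_tripleBracket _ (map_fusIncl_bracket h hbr),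
      tripleBracket_extFusBracket h hqp hij hbr, map_smul, map_sum]
    refine congrArg _ (Finset.sum_congr rfl fun s _ ↦ ?_)
    exact (map₃_trivectorBracket (fusIncl k h) (cornerIncl_mul _)
      (map_fusIncl_gaugeElt h hqp.idem s.2) a b c).symm

end FusionOfIdempotents

end DoubleBrackets

end

/-- If `A` is a double quasi-Poisson algebra over `B = ⨁ k e_s`, then the algebra obtained by fusing
`e_j` onto `e_i` is a double quasi-Poisson algebra over `B^f = ⨁_{s ≠ j} k e_s` for the sum of the
induced double bracket and of the double bracket defined by `-1/2 Tr(E_i) Tr(E_j)`. -/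
theorem theorem2 {k : Type*} [Field k] [CharZero k] {A : Type*} [Ring A] [Algebra k A]
    {I : Type*} [Fintype I] [DecidableEq I] (e : I → A)
    (br : A →ₗ[k] A →ₗ[k] TensorProduct k A A)
    (h : DoubleBrackets.IsDoubleQuasiPoisson e br) (i j : I) (hij : i ≠ j) :
    DoubleBrackets.IsDoubleQuasiPoisson
      (fun s : {s : I // s ≠ j} ↦
        DoubleBrackets.toFus k (h.idem.isOrthogonalPair hij) (e s))
      (DoubleBrackets.inducedBracket (h.idem.isOrthogonalPair hij) br
          (h.isDoubleBracket_base hij) +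
        DoubleBrackets.fusBracket k (h.idem.isOrthogonalPair hij)) := by
  exact DoubleBrackets.isDoubleQuasiPoisson_fusion _ h hij _
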